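/- **Model.** In the congested clique there are $n$ nodes $1,\dots,n$ and computation proceeds in synchronous rounds; in each round every node sends to each node a message of $\lceil\log_2 n\rceil$ bits (messages to different nodes may differ). Local computation is unrestricted, and each node has private randomness, namely a seed drawn uniformly from a finite set, the seeds of different nodes being independent. The input is a simple graph $G$ on the vertex set $\{1,\dots,n\}$, and initially node $\ell$ knows only its own name, its neighbours in $G$ and its seed. A graph problem has randomized round complexity $O(g(n))$ if for every $c\in\mathbb N$ there are a constant $C$ and, for each $n\ge 2$, a protocol that stops after at most $C\,g(n)$ rounds and such that, for every input graph $G$ on $\{1,\dots,n\}$, with probability at least $1-n^{-c}$ all nodes output the correct answer. **Exponent.** Let $F$ be a field. An algebraic algorithm of rank $t$ for the product of two $n\times n$ matrices over $F$ consists of coefficients $\alpha_{ij\mu},\beta_{ij\mu},\lambda_{ij\mu}\in F$ with $1 \le i,j \le n$ and $1 \le \mu \le t$ such that $$(AB)[i,j]=\sum_{\mu=1}^{t}\lambda_{ij\mu}\Big(\sum_{i',j'}\alpha_{i'j'\mu}A[i',j']\Big)\Big(\sum_{i',j'}\beta_{i'j'\mu}B[j',i']\Big)$$ for all $A,B\in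 F^{n\times n}$ and all $i,j$. Let $\omega=\omega(F)$ be the least real $\tau$ such that, for every $\varepsilon>0$, products of two $n\times n$ matrices over $F$ have algebraic algorithms of rank $O(n^{\tau+\varepsilon})$. **Theorem.** Consider the problem of computing the number of edges in a maximum matching of a simple graph with $n$ vertices. 1. For every field $F$, its randomized round complexity in the congested clique is $O(n^{1-2/\omega+o(1)}\log n)$, that is, $O(n^{1-2/\omega+\varepsilon}\log n)$ for every $\varepsilon>0$. 2. If $F$ is finite and $\tau$ is a real number such that products of two $n\times n$ matrices over $F$ have algebraic algorithms of rank $O(n^{\tau})$, then its randomized round complexity in the congested clique is $O(n^{1-2/\tau}\log n)$; in particular it is $O(n^{1-2/\omega}\log n)$ if this holds with $\tau=\omega$. -/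

import Mathlib

open scoped BigOperators

/-! ### Maximum matchings -/

/-- The number of edges in a maximum matching of a graph (used for graphs on finitely many
vertices, where the supremum is over a finite nonempty set and hence a maximum). -/
noncomputable def matchingNumber {V : Type*} (G : SimpleGraph V) : ℕ :=
  sSup {k : ℕ | ∃ M : G.Subgraph, M.IsMatching ∧ M.edgeSet.ncard = k}

/-! ### Algebraic algorithms for matrix multiplication and the exponent `ω` -/

/-- An algebraic (bilinear) algorithm of rank `t` computing the product of an `n × m` matrix
by an `m × n` matrix over `F`. -/
structure AlgebraicAlgorithm (F : Type*) [Field F] (n m t : ℕ) where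
  /-- coefficients of the linear forms in the entries of the left factor -/
  α : Fin n → Fin m → Fin t → F
  /-- coefficients of the linear forms in the entries of the right factor -/
  β : Fin n → Fin m → Fin t → F
  /-- coefficients of the products in the entries of the result -/
  coeff : Fin n → Fin n → Fin t → F
  correct : ∀ (A : Matrix (Fin n) (Fin m) F) (B : Matrix (Fin m) (Fin n) F) (i j : Fin n),
    (A * B) i j = ∑ μ : Fin t, coeff i j μ *
      ((∑ i' : Fin n, ∑ j' : Fin m, α i' j' μ * A i' j') *
        (∑ i' : Fin n, ∑ j' : Fin m, β i' j' μ * B j' i'))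

/-- Products of two `n × n` matrices over `F` are computed by algebraic algorithms of rank
`O(n ^ τ)`. -/
def SquareProductRankO (F : Type*) [Field F] (τ : ℝ) : Prop :=
  ∃ C : ℝ, ∀ n : ℕ, 1 ≤ n →
    ∃ t : ℕ, (t : ℝ) ≤ C * (n : ℝ) ^ τ ∧ Nonempty (AlgebraicAlgorithm F n n t)

/-- The exponent `ω` of square matrix multiplication over `F`: the least `τ` such that products
of two `n × n` matrices are computed with rank `O(n ^ (τ + ε))` for every `ε > 0`. -/
noncomputable def omegaExponent (F : Type*) [Field F] : ℝ :=
  sInf {τ : ℝ | ∀ ε : ℝ, 0 < ε → SquareProductRankO F (τ + ε)}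

/-! ### The congested clique model -/

/-- A message: a word of `⌈log₂ n⌉` bits. -/
abbrev Message (n : ℕ) : Type := Fin (Nat.clog 2 n) → Bool

/-- A randomized protocol for the congested clique with `n` nodes, for problems whose input is a
graph on the node set. Every node initially knows its own name, the set of its neighbours in the
input graph (its row, equivalently its column, of the adjacency matrix) and a private seed. In
each synchronous round every node sends one message to each node, depending on the recipient.
Local computation is unrestricted. -/
structure CliqueProtocol (n : ℕ) (Out : Type) where
  /-- local states of the nodes -/
  State : Type
  /-- values of the private random seed of a node -/
  Seed : Type
  [fintypeSeed : Fintype Seed]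
  [nonemptySeed : Nonempty Seed]
  /-- `init v N s`: initial state of node `v` with set of neighbours `N` and seed `s` -/
  init : Fin n → Set (Fin n) → Seed → State
  /-- `send v q u`: message that node `v` in state `q` sends to node `u` -/
  send : Fin n → State → Fin n → Message n
  /-- `next v q r`: new state of node `v` in state `q` when `r u` is the message from `u` -/
  next : Fin n → State → (Fin n → Message n) → State
  /-- the value that a node outputs when it stops -/
  output : Fin n → State → Out

namespace CliqueProtocol

attribute [instance] CliqueProtocol.fintypeSeed CliqueProtocol.nonemptySeed

variable {n : ℕ} {Out : Type}

/-- The states of all the nodes after `T` rounds on input `G`, when the seed of `v` is `ρ v`. -/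
def run (P : CliqueProtocol n Out) (G : SimpleGraph (Fin n)) (ρ : Fin n → P.Seed) :
    ℕ → Fin n → P.State
  | 0 => fun v => P.init v (G.neighborSet v) (ρ v)
  | T + 1 => fun v => P.next v (P.run G ρ T v) (fun u => P.send u (P.run G ρ T u) v)

/-- The probability, over independent and uniformly distributed seeds of the nodes, that after
`T` rounds on input `G` every node outputs `a`. -/
noncomputable def successProb (P : CliqueProtocol n Out) (T : ℕ) (G : SimpleGraph (Fin n))
    (a : Out) : ℝ :=
  (Nat.card {ρ : Fin n → P.Seed // ∀ v, P.output v (P.run G ρ T v) = a} : ℝ) /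
    (Nat.card (Fin n → P.Seed) : ℝ)

end CliqueProtocol

/-- The randomized round complexity, in the congested clique, of the graph problem `f` is
`O(g n)`: for every exponent `c` there are protocols for all numbers `n` of nodes which stop
after `O(g n)` rounds and with which, on every input graph, all nodes output the correct answer
with probability at least `1 - 1 / n ^ c`. -/
def RandomizedRoundsO {Out : Type} (f : ∀ n : ℕ, SimpleGraph (Fin n) → Out) (g : ℕ → ℝ) : Prop :=
  ∀ c : ℕ, ∃ C : ℝ, ∀ n : ℕ, 2 ≤ n →
    ∃ (P : CliqueProtocol n Out) (T : ℕ), (T : ℝ) ≤ C * g n ∧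
      ∀ G : SimpleGraph (Fin n), 1 - 1 / (n : ℝ) ^ c ≤ P.successProb T G (f n G)

/-!
For random weights from a large finite field, the rank of the Tutte matrix `T` of `G` is twice the
matching number. If moreover `Y` is a random matrix, then this rank is also the rank of the Hankel
matrix of the sequence `1ᵀ (T Y) ^ k 1`: its rank is at most that of `T`, and if `T` is the Tutte
matrix of a maximum matching, `Y` can be chosen such that `T Y` is a diagonal matrix with distinct
nonzero entries at the matched vertices; the Schwartz-Zippel lemma does the rest.

The vectors `(T Y) ^ k 1` are computed with `O(log n)` matrix products by repeated squaring. With a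
bilinear algorithm of rank at most `n` for `m × m` matrices, a product is computed by splitting the
matrices into `m × m` blocks of size about `n / m` and letting node `μ` multiply the `μ`-th pair of
linear forms in the blocks. By an edge colouring argument, messages can be routed at full bandwidth,
and a product takes `O(n / m ^ 2)` rounds; this is `O(n ^ (1 - 2 / τ))` if `m` is about
`n ^ (1 / τ)`.

For an infinite field, the coefficients of a bilinear algorithm generate a finitely generated ring,
which has a finite residue field because `ℤ` is a Jacobson ring.
-/

namespace CongestedClique

/-! ### Uniform probability -/

section Probability

variable {α β : Type*}

/-- The probability of the event `p` when a point of the finite type `α` is chosen uniformly. -/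
noncomputable def prob (p : α → Prop) : ℝ :=
  (Nat.card {a // p a} : ℝ) / Nat.card α

lemma prob_mono [Finite α] {p q : α → Prop} (h : ∀ a, p a → q a) : prob p ≤ prob q := by
  unfold prob
  gcongr
  exact Nat.card_le_card_of_injective _ (Subtype.impEmbedding p q h).injective

lemma prob_comp_equiv (e : α ≃ β) (p : β → Prop) : prob (fun a => p (e a)) = prob p := by
  unfold prob
  rw [Nat.card_congr e, Nat.card_congr (e.subtypeEquiv fun _ => Iff.rfl)]

lemma prob_not [Finite α] [Nonempty α] (p : α → Prop) : prob (fun a => ¬p a) = 1 - prob p := by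
  classical
  have hα : (Nat.card α : ℝ) ≠ 0 := Nat.cast_ne_zero.mpr Nat.card_pos.ne'
  have hsum : (Nat.card α : ℝ) = Nat.card {a // p a} + Nat.card {a // ¬p a} := by
    rw [← Nat.card_congr (Equiv.sumCompl p), Nat.card_sum, Nat.cast_add]
  rw [prob, prob, eq_sub_iff_add_eq, ← add_div, add_comm, ← hsum, div_self hα]

end Probability

/-! ### Knowledge in the congested clique -/

section Knowledge

variable {n : ℕ} {S : Type}

/-- The data that determine a run: the input graph and the seeds of all nodes. -/
abbrev Input (n : ℕ) (S : Type) : Type := SimpleGraph (Fin n) × (Fin n → S)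

/-- An observer who cannot tell apart the points related by `r` knows the value of `g`. -/
def Knows {Ω β : Type*} (r : Setoid Ω) (g : Ω → β) : Prop :=
  ∀ ⦃a b⦄, r a b → g a = g b

namespace Knows

variable {Ω β γ δ : Type*} {r r' : Setoid Ω}

lemma mono {g : Ω → β} (h : Knows r g) (hr : r' ≤ r) : Knows r' g :=
  fun _ _ hab => h (hr hab)

lemma const (c : β) : Knows r fun _ => c :=
  fun _ _ _ => rfl

lemma comp {g : Ω → β} (h : Knows r g) (φ : β → γ) : Knows r fun a => φ (g a) :=
  fun _ _ hab => congrArg φ (h hab)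

lemma comp₂ {g : Ω → β} {g' : Ω → γ} (h : Knows r g) (h' : Knows r g') (φ : β → γ → δ) :
    Knows r fun a => φ (g a) (g' a) :=
  fun _ _ hab => congrArg₂ φ (h hab) (h' hab)

lemma pi {ι : Type*} {g : ι → Ω → β} (h : ∀ i, Knows r (g i)) : Knows r fun a i => g i a :=
  fun _ _ hab => funext fun i => h i hab

lemma sum {ι : Type*} [AddCommMonoid β] {s : Finset ι} {g : ι → Ω → β}
    (h : ∀ i ∈ s, Knows r (g i)) : Knows r fun a => ∑ i ∈ s, g i a :=
  fun _ _ hab => Finset.sum_congr rfl fun i hi => h i hi hab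

lemma apply_epsilon [Nonempty Ω] {g : Ω → β} (h : Knows r g) (a : Ω) :
    g (Classical.epsilon fun b => r b a) = g a :=
  h (Classical.epsilon_spec (p := fun b => r b a) ⟨a, r.refl a⟩)

end Knows

/-- The knowledge of node `v` after `T` rounds, in which node `u` sends the message `m r u v a` to
node `v` in round `r` on input `a`: the inputs which `v` cannot tell apart. -/
def knowledge (m : ℕ → Fin n → Fin n → Input n S → Message n) : ℕ → Fin n → Setoid (Input n S)
  | 0, v => Setoid.ker fun a => (a.1.neighborSet v, a.2 v)
  | T + 1, v => knowledge m T v ⊓ Setoid.ker fun a u => m T u v a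

/-- After `T` rounds every node `v` can have the knowledge `κ v`. Every message has to be determined
by what its sender knows in the round in which it is sent. -/
def Reachable (T : ℕ) (κ : Fin n → Setoid (Input n S)) : Prop :=
  ∃ m, (∀ r < T, ∀ u v, Knows (knowledge m r u) (m r u v)) ∧ knowledge m T = κ

lemma knowledge_update (m : ℕ → Fin n → Fin n → Input n S → Message n)
    (m' : Fin n → Fin n → Input n S → Message n) {r T : ℕ} (h : r ≤ T) :
    knowledge (Function.update m T m') r = knowledge m r := by
  induction r with
  | zero => rfl
  | succ r ih =>
    funext v
    rw [knowledge, knowledge, ih (by omega), Function.update_of_ne (by omega)]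

namespace Reachable

variable {T T' w : ℕ} {κ : Fin n → Setoid (Input n S)}

lemma zero : Reachable 0 fun v => Setoid.ker fun a : Input n S => (a.1.neighborSet v, a.2 v) :=
  ⟨fun _ _ _ _ _ => false, by simp, rfl⟩

lemma round (h : Reachable T κ) (m : Fin n → Fin n → Input n S → Message n)
    (hm : ∀ u v, Knows (κ u) (m u v)) :
    ∃ κ' ≤ κ, Reachable (T + 1) κ' ∧ ∀ u v, Knows (κ' v) (m u v) := by
  obtain ⟨m₀, hm₀, rfl⟩ := h
  refine ⟨fun v => knowledge m₀ T v ⊓ Setoid.ker fun a u => m u v a, fun v => inf_le_left,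
    ⟨Function.update m₀ T m, fun r hr => ?_, ?_⟩, fun u v a b hab => congrFun hab.2 u⟩
  · rw [knowledge_update _ _ (Nat.le_of_lt_succ hr)]
    obtain rfl | hne := eq_or_ne r T
    · simpa only [Function.update_self] using hm
    · simpa only [Function.update_of_ne hne] using hm₀ r (by omega)
  · funext v
    rw [knowledge, knowledge_update _ _ le_rfl, Function.update_self]

lemma rounds (h : Reachable T κ) {R : ℕ} (m : Fin R → Fin n → Fin n → Input n S → Message n)
    (hm : ∀ r u v, Knows (κ u) (m r u v)) :
    ∃ κ' ≤ κ, Reachable (T + R) κ' ∧ ∀ r u v, Knows (κ' v) (m r u v) := by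
  induction R with
  | zero => exact ⟨κ, le_rfl, h, fun r => r.elim0⟩
  | succ R ih =>
    obtain ⟨κ₁, hκ₁, h₁, hm₁⟩ := ih (fun r => m r.castSucc) fun r => hm r.castSucc
    obtain ⟨κ₂, hκ₂, h₂, hm₂⟩ := h₁.round (m (Fin.last R))
      fun u v => (hm _ u v).mono (hκ₁ u)
    exact ⟨κ₂, hκ₂.trans hκ₁, h₂,
      Fin.lastCases hm₂ fun r u v => (hm₁ r u v).mono (hκ₂ v)⟩

lemma wait (h : Reachable T κ) (hT : T ≤ T') : ∃ κ' ≤ κ, Reachable T' κ' := by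
  obtain ⟨R, rfl⟩ := Nat.exists_eq_add_of_le hT
  obtain ⟨κ', hκ', h', -⟩ := h.rounds (fun (_ : Fin R) _ _ _ _ => false)
    fun _ _ _ => Knows.const _
  exact ⟨κ', hκ', h'⟩

lemma exchange (h : Reachable T κ) {W : Type*} (enc : W ↪ (Fin w → Message n))
    (val : Fin n → Fin n → Input n S → W) (hval : ∀ u v, Knows (κ u) (val u v)) :
    ∃ κ' ≤ κ, Reachable (T + w) κ' ∧ ∀ u v, Knows (κ' v) (val u v) := by
  obtain ⟨κ', hκ', h', hm⟩ := h.rounds (fun k u v a => enc (val u v a) k)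
    fun k u v => (hval u v).comp fun x => enc x k
  exact ⟨κ', hκ', h', fun u v a b hab =>
    enc.injective (funext fun k => hm k u v hab)⟩

end Reachable

/-- The protocol that sends the messages `m` and outputs the value of `f`. The state of a node is
the number of past rounds together with the set of inputs which it considers possible; every member
of this set yields the same next messages and, in the end, the same output. -/
noncomputable def possibleInputsProtocol [Fintype S] [Nonempty S] {Out : Type}
    (m : ℕ → Fin n → Fin n → Input n S → Message n) (f : Input n S → Out) :
    CliqueProtocol n Out where
  State := ℕ × Set (Input n S)
  Seed := S
  init v N s := (0, {a | a.1.neighborSet v = N ∧ a.2 v = s})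
  send v q u := m q.1 v u (Classical.epsilon (· ∈ q.2))
  next v q r := (q.1 + 1, {a ∈ q.2 | ∀ u, m q.1 u v a = r u})
  output _ q := f (Classical.epsilon (· ∈ q.2))

lemma possibleInputsProtocol_run [Fintype S] [Nonempty S] {Out : Type}
    {m : ℕ → Fin n → Fin n → Input n S → Message n} (f : Input n S → Out) {T : ℕ}
    (hm : ∀ r < T, ∀ u v, Knows (knowledge m r u) (m r u v)) (G : SimpleGraph (Fin n))
    (ρ : Fin n → S) {r : ℕ} (hr : r ≤ T) :
    (possibleInputsProtocol m f).run G ρ r =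
      fun v => (r, {a | knowledge m r v a (G, ρ)}) := by
  induction r with
  | zero =>
    funext v
    exact congrArg (Prod.mk 0) (Set.ext fun a => Prod.mk_inj.symm)
  | succ r ih =>
    have hsend (u v : Fin n) := (hm r (by omega) u v).apply_epsilon (G, ρ)
    funext v
    simp only [CliqueProtocol.run, ih (by omega)]
    simp only [possibleInputsProtocol, Set.mem_ofPred_eq, hsend]
    exact congrArg (Prod.mk (r + 1)) (Set.ext fun a => and_congr_right' funext_iff.symm)

theorem Reachable.exists_protocol [Finite S] [Nonempty S] {T : ℕ}
    {κ : Fin n → Setoid (Input n S)} (h : Reachable T κ) {Out : Type} (f : Input n S → Out)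
    (hf : ∀ v, Knows (κ v) f) :
    ∃ P : CliqueProtocol n Out, ∀ G a,
      prob (fun ρ : Fin n → S => f (G, ρ) = a) ≤ P.successProb T G a := by
  have := Fintype.ofFinite S
  obtain ⟨m, hm, rfl⟩ := h
  refine ⟨possibleInputsProtocol m f, fun G a => prob_mono fun ρ hρ v => ?_⟩
  rw [possibleInputsProtocol_run f hm G ρ le_rfl, ← hρ]
  exact (hf v).apply_epsilon (G, ρ)

end Knowledge

/-! ### Routing -/

section Routing

lemma card_fiber_le {α β γ : Type*} [Finite γ] {f : α → β} {g : α → γ}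
    (h : Function.Injective fun x => (f x, g x)) (b : β) :
    Nat.card {x // f x = b} ≤ Nat.card γ :=
  Nat.card_le_card_of_injective (fun x => g x) fun x y hxy =>
    Subtype.ext (h (Prod.ext (x.2.trans y.2.symm) hxy))

lemma nonempty_coloring_of_ncard_neighborSet_lt {M C : Type*} [Finite M] [Finite C]
    {G : SimpleGraph M} (h : ∀ m, (G.neighborSet m).ncard < Nat.card C) :
    Nonempty (G.Coloring C) := by
  classical
  have := Fintype.ofFinite M
  have hpartial (s : Finset M) :
      ∃ col : M → C, ∀ x ∈ s, ∀ y ∈ s, G.Adj x y → col x ≠ col y := by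
    induction s using Finset.induction_on with
    | empty => exact ⟨fun m => (Finite.card_pos_iff.mp (Nat.zero_lt_of_lt (h m))).some, by simp⟩
    | insert m s _ ih =>
      obtain ⟨col, hcol⟩ := ih
      obtain ⟨c, hc⟩ : ∃ c, c ∉ col '' G.neighborSet m := by
        by_contra! hall
        refine ((Set.ncard_image_le (f := col) (Set.toFinite _)).trans_lt (h m)).ne ?_
        rw [Set.eq_univ_of_forall hall, Set.ncard_univ]
      have hne (x : M) (hx : G.Adj m x) : col x ≠ c := fun hxc => hc ⟨x, hx, hxc⟩
      refine ⟨Function.update col m c, fun x hx y hy hxy => ?_⟩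
      grind [G.ne_of_adj hxy, G.adj_symm hxy]
  obtain ⟨col, hcol⟩ := hpartial Finset.univ
  exact ⟨.mk col fun hxy => hcol _ (by simp) _ (by simp) hxy⟩

/-- The edges of a bipartite multigraph of maximum degree `Δ` have a proper colouring with `2 * Δ`
colours. -/
lemma exists_edgeColoring {M V C : Type*} [Finite M] [Finite C] (src dst : M → V) {Δ : ℕ}
    (hsrc : ∀ v, Nat.card {m // src m = v} ≤ Δ) (hdst : ∀ v, Nat.card {m // dst m = v} ≤ Δ)
    (hC : 2 * Δ ≤ Nat.card C) :
    ∃ col : M → C, (Function.Injective fun m => (src m, col m)) ∧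
      Function.Injective fun m => (dst m, col m) := by
  let G : SimpleGraph M := .fromRel fun x y => src x = src y ∨ dst x = dst y
  have hG (m : M) : (G.neighborSet m).ncard < Nat.card C := by
    have hsub : G.neighborSet m ⊆ {x | src x = src m} \ {m} ∪ {x | dst x = dst m} \ {m} := by
      intro x hx
      grind [SimpleGraph.mem_neighborSet, SimpleGraph.fromRel_adj]
    have hcard := (Set.ncard_le_ncard hsub (Set.toFinite _)).trans (Set.ncard_union_le _ _)
    have hs := Set.ncard_sdiff_singleton_lt_of_mem (s := {x | src x = src m}) (a := m) rfl
    have hd := Set.ncard_sdiff_singleton_lt_of_mem (s := {x | dst x = dst m}) (a := m) rfl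
    have := hs.trans_le (hsrc (src m))
    have := hd.trans_le (hdst (dst m))
    omega
  obtain ⟨col⟩ := nonempty_coloring_of_ncard_neighborSet_lt hG
  have hcol (x y : M) (h : src x = src y ∨ dst x = dst y) (hxy : col x = col y) : x = y := by
    by_contra hne
    exact col.valid ((SimpleGraph.fromRel_adj _ _ _).mpr ⟨hne, .inl h⟩) hxy
  exact ⟨col, fun x y hxy => hcol x y (.inl (congrArg Prod.fst hxy)) (congrArg Prod.snd hxy),
    fun x y hxy => hcol x y (.inr (congrArg Prod.fst hxy)) (congrArg Prod.snd hxy)⟩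

lemma exists_packing {Ω M U I J W : Type*} [Nonempty W] {src : M → U} {col : M → I × J}
    (hinj : Function.Injective fun m => (src m, col m)) (val : M → Ω → W) :
    ∃ pack : U → J → Ω → I → W, (∀ m a, pack (src m) (col m).2 a (col m).1 = val m a) ∧
      ∀ u j (r : Setoid Ω), (∀ m, src m = u → (col m).2 = j → Knows r (val m)) →
        Knows r (pack u j) := by
  classical
  let pack (u : U) (j : J) (a : Ω) (i : I) : W :=
    if h : ∃ m, src m = u ∧ col m = (i, j) then val h.choose a else Classical.arbitrary W
  refine ⟨pack, fun m a => ?_, fun u j r hr => Knows.pi fun i => ?_⟩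
  · have hex : ∃ m', src m' = src m ∧ col m' = ((col m).1, (col m).2) := ⟨m, rfl, rfl⟩
    have hm : hex.choose = m := hinj (Prod.ext hex.choose_spec.1 hex.choose_spec.2)
    simp only [pack, hex, ↓reduceDIte, hm]
  · by_cases hex : ∃ m, src m = u ∧ col m = (i, j)
    · simpa only [pack, hex, ↓reduceDIte] using
        hr _ hex.choose_spec.1 (congrArg Prod.snd hex.choose_spec.2)
    · simpa only [pack, hex, ↓reduceDIte] using Knows.const _

variable {n : ℕ} {S : Type} {T L w : ℕ} {κ : Fin n → Setoid (Input n S)} {W : Type*}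

/-- An encoding of vectors of length `L` by concatenation. -/
def vectorEncoding (L : ℕ) (enc : W ↪ (Fin w → Message n)) :
    (Fin L → W) ↪ (Fin (L * w) → Message n) :=
  (enc.arrowCongrRight.trans (Equiv.curry (Fin L) (Fin w) (Message n)).symm.toEmbedding).trans
    (finProdFinEquiv.arrowCongr (.refl _)).toEmbedding

/-- A value of colour `(l, c)` is the `l`-th of the values which its source sends to the relay `c`,
and the `l`-th of those which the relay sends to its destination. -/
lemma Reachable.route (h : Reachable T κ) [Nonempty W] (enc : W ↪ (Fin w → Message n))
    {M : Type*} [Finite M] {src dst : M → Fin n}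
    (hsrc : ∀ v, Nat.card {m // src m = v} ≤ L * n) (hdst : ∀ v, Nat.card {m // dst m = v} ≤ L * n)
    {val : M → Input n S → W} (hval : ∀ m, Knows (κ (src m)) (val m)) :
    ∃ κ' ≤ κ, Reachable (T + 4 * (L * w)) κ' ∧ ∀ m, Knows (κ' (dst m)) (val m) := by
  obtain ⟨col, hcol_src, hcol_dst⟩ := exists_edgeColoring (C := Fin (2 * L) × Fin n) src dst
    hsrc hdst (by simp [mul_assoc])
  obtain ⟨out, hout, knows_out⟩ := exists_packing hcol_src val
  obtain ⟨inc, hinc, knows_inc⟩ := exists_packing hcol_dst val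
  obtain ⟨κ₁, hκ₁, h₁, hval₁⟩ := h.exchange (vectorEncoding (2 * L) enc) out
    fun u c => knows_out u c _ fun m hm _ => hm ▸ hval m
  have hrelay (m : M) : Knows (κ₁ (col m).2) (val m) := by
    simpa only [hout] using (hval₁ (src m) (col m).2).comp fun x => x (col m).1
  obtain ⟨κ₂, hκ₂, h₂, hval₂⟩ := h₁.exchange (vectorEncoding (2 * L) enc)
    (fun c v => inc v c) fun c v => knows_inc v c _ fun m _ hm => hm ▸ hrelay m
  refine ⟨κ₂, hκ₂.trans hκ₁, ?_, fun m => ?_⟩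
  · convert h₂ using 1
    ring
  · simpa only [hinc] using (hval₂ (col m).2 (dst m)).comp fun x => x (col m).1

end Routing

/-! ### Bilinear algorithms for matrix multiplication -/

section BilinearRank

open Matrix

variable {R : Type*} [CommRing R] {ι ι' τ τ' : Type*} [DecidableEq ι] [DecidableEq ι']
  [Fintype τ] [Fintype τ'] {α β γ : τ → Matrix ι ι R}

/-- Brent's equations: the products of the linear forms with coefficients `α μ` and `β μ` in the
entries of two matrices, weighted by `γ μ`, add up to the matrix product. -/
def BrentEquations (α β γ : τ → Matrix ι ι R) : Prop :=
  ∀ i j a b c d, ∑ μ, γ μ i j * (α μ a b * β μ c d) = if a = i ∧ b = c ∧ d = j then 1 else 0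

/-- Products of `n × n` matrices over the commutative ring `R` have bilinear algorithms of
rank `t`. -/
def HasMulRank (R : Type*) [CommRing R] (n t : ℕ) : Prop :=
  ∃ α β γ : Fin t → Matrix (Fin n) (Fin n) R, BrentEquations α β γ

namespace BrentEquations

lemma map {R' : Type*} [CommRing R'] (h : BrentEquations α β γ) (f : R →+* R') :
    BrentEquations (fun μ => (α μ).map f) (fun μ => (β μ).map f) (fun μ => (γ μ).map f) := by
  intro i j a b c d
  simpa only [map_apply, map_sum, map_mul, apply_ite f, map_one, map_zero] using
    congrArg f (h i j a b c d)

lemma of_map {R' : Type*} [CommRing R'] {f : R →+* R'} (hf : Function.Injective f)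
    (h : BrentEquations (fun μ => (α μ).map f) (fun μ => (β μ).map f) fun μ => (γ μ).map f) :
    BrentEquations α β γ := by
  intro i j a b c d
  refine hf ?_
  simpa only [map_apply, map_sum, map_mul, apply_ite f, map_one, map_zero] using h i j a b c d

lemma submatrix (h : BrentEquations α β γ) (e : ι' ↪ ι) (f : τ' ≃ τ) :
    BrentEquations (fun μ => (α (f μ)).submatrix e e) (fun μ => (β (f μ)).submatrix e e)
      fun μ => (γ (f μ)).submatrix e e := by
  intro i j a b c d
  simp only [submatrix_apply]
  rw [f.sum_comp fun μ => γ μ (e i) (e j) * (α μ (e a) (e b) * β μ (e c) (e d)), h]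
  simp only [e.apply_eq_iff_eq]

lemma kronecker (h : BrentEquations α β γ) {α' β' γ' : τ' → Matrix ι' ι' R}
    (h' : BrentEquations α' β' γ') :
    BrentEquations (fun μ : τ × τ' => kroneckerMap (· * ·) (α μ.1) (α' μ.2))
      (fun μ => kroneckerMap (· * ·) (β μ.1) (β' μ.2))
      fun μ => kroneckerMap (· * ·) (γ μ.1) (γ' μ.2) := by
  intro i j a b c d
  calc ∑ μ : τ × τ', γ μ.1 i.1 j.1 * γ' μ.2 i.2 j.2 *
        (α μ.1 a.1 b.1 * α' μ.2 a.2 b.2 * (β μ.1 c.1 d.1 * β' μ.2 c.2 d.2))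
      = (∑ μ, γ μ i.1 j.1 * (α μ a.1 b.1 * β μ c.1 d.1)) *
          ∑ μ, γ' μ i.2 j.2 * (α' μ a.2 b.2 * β' μ c.2 d.2) := by
        rw [Fintype.sum_mul_sum, Fintype.sum_prod_type]
        exact Finset.sum_congr rfl fun _ _ => Finset.sum_congr rfl fun _ _ => by ring
    _ = if a = i ∧ b = c ∧ d = j then 1 else 0 := by
        rw [h, h', ite_zero_mul_ite_zero, mul_one]
        simp only [Prod.ext_iff]
        exact if_congr (by tauto) rfl rfl

lemma linearIndependent_left [Finite ι] (h : BrentEquations α β γ) :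
    LinearIndependent R fun (p : ι × ι) μ => α μ p.1 p.2 := by
  have := Fintype.ofFinite ι
  rw [Fintype.linearIndependent_iff]
  rintro x hx ⟨i, d⟩
  have hx' (μ : τ) : ∑ p : ι × ι, x p * α μ p.1 p.2 = 0 := by simpa using congrFun hx μ
  calc x (i, d)
      = ∑ p : ι × ι, x p * if p.1 = i ∧ p.2 = d ∧ i = i then 1 else 0 := by
        simp [← Prod.mk_inj, Finset.sum_ite_eq']
    _ = ∑ p : ι × ι, ∑ μ, γ μ i i * β μ d i * (x p * α μ p.1 p.2) := by
        refine Finset.sum_congr rfl fun p _ => ?_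
        rw [← h i i p.1 p.2 d i, Finset.mul_sum]
        exact Finset.sum_congr rfl fun _ _ => by ring
    _ = ∑ μ, γ μ i i * β μ d i * ∑ p : ι × ι, x p * α μ p.1 p.2 := by
        rw [Finset.sum_comm]
        simp only [Finset.mul_sum]
    _ = 0 := by simp only [hx', mul_zero, Finset.sum_const_zero]

/-- The entries of the matrices may lie in any algebra, for instance in a ring of matrices. -/
lemma mul_apply [Fintype ι] {𝒜 : Type*} [Semiring 𝒜] [Algebra R 𝒜] (h : BrentEquations α β γ)
    (X Y : Matrix ι ι 𝒜) (i j : ι) :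
    (X * Y) i j = ∑ μ, γ μ i j •
      ((∑ p : ι × ι, α μ p.1 p.2 • X p.1 p.2) * ∑ q : ι × ι, β μ q.1 q.2 • Y q.1 q.2) := by
  calc (X * Y) i j
      = ∑ p : ι × ι, ∑ q : ι × ι,
          (if p.1 = i ∧ p.2 = q.1 ∧ q.2 = j then (1 : R) else 0) • (X p.1 p.2 * Y q.1 q.2) := by
        simp only [Matrix.mul_apply, Fintype.sum_prod_type, ite_smul, one_smul, zero_smul, ite_and,
          Finset.sum_ite_eq', Finset.sum_ite_irrel, Finset.sum_const_zero, Finset.mem_univ,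
          if_true, Finset.sum_ite_eq]
    _ = ∑ p : ι × ι, ∑ q : ι × ι, ∑ μ,
          (γ μ i j * (α μ p.1 p.2 * β μ q.1 q.2)) • (X p.1 p.2 * Y q.1 q.2) := by
        simp only [← Finset.sum_smul, h i j]
    _ = ∑ μ, ∑ p : ι × ι, ∑ q : ι × ι,
          (γ μ i j * (α μ p.1 p.2 * β μ q.1 q.2)) • (X p.1 p.2 * Y q.1 q.2) := by
        simp only [Finset.sum_comm (γ := τ)]
    _ = _ := by simp only [Finset.sum_mul_sum, Finset.smul_sum, smul_mul_smul_comm, mul_smul]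

end BrentEquations

namespace HasMulRank

variable {n n' t t' : ℕ}

lemma of_algebraicAlgorithm {F : Type*} [Field F] (P : AlgebraicAlgorithm F n n t) :
    HasMulRank F n t := by
  refine ⟨fun μ i j => P.α i j μ, fun μ i j => P.β j i μ, fun μ i j => P.coeff i j μ,
    fun i j a b c d => ?_⟩
  have h := P.correct (single a b 1) (single c d 1) i j
  simp only [single_apply, mul_ite, mul_one, mul_zero, ite_and, Finset.sum_ite_irrel,
    Finset.sum_ite_eq, Finset.sum_const_zero, Finset.mem_univ, if_true] at h
  rw [← h]
  obtain rfl | hbc := eq_or_ne b c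
  · simp [single_apply, ite_and]
  · simp [hbc]

lemma map {R' : Type*} [CommRing R'] (h : HasMulRank R n t) (f : R →+* R') :
    HasMulRank R' n t :=
  let ⟨_, _, _, h⟩ := h; ⟨_, _, _, h.map f⟩

lemma restrict (h : HasMulRank R n' t) (hn : n ≤ n') : HasMulRank R n t :=
  let ⟨_, _, _, h⟩ := h; ⟨_, _, _, h.submatrix (Fin.castLEEmb hn) (.refl _)⟩

lemma one : HasMulRank R 1 1 :=
  ⟨fun _ _ _ => 1, fun _ _ _ => 1, fun _ _ _ => 1, fun _ _ _ _ _ _ => by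
    simp [eq_iff_true_of_subsingleton]⟩

lemma mul (h : HasMulRank R n t) (h' : HasMulRank R n' t') :
    HasMulRank R (n * n') (t * t') :=
  let ⟨_, _, _, h⟩ := h
  let ⟨_, _, _, h'⟩ := h'
  ⟨_, _, _, (h.kronecker h').submatrix finProdFinEquiv.symm.toEmbedding finProdFinEquiv.symm⟩

lemma pow (h : HasMulRank R n t) (k : ℕ) : HasMulRank R (n ^ k) (t ^ k) := by
  induction k with
  | zero => simpa only [pow_zero] using one
  | succ k ih => simpa only [pow_succ] using ih.mul h

lemma mul_self_le [Nontrivial R] (h : HasMulRank R n t) : n * n ≤ t := by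
  obtain ⟨α, β, γ, h⟩ := h
  simpa using h.linearIndependent_left.fintype_card_le_finrank

end HasMulRank

/-! ### Passing to a finite field -/

theorem isJacobsonRing_int : IsJacobsonRing ℤ := by
  refine isJacobsonRing_iff_prime_eq.mpr fun P hP => ?_
  obtain rfl | hP₀ := eq_or_ne P ⊥
  · refine le_antisymm (fun x hx => ?_) Ideal.le_jacobson
    have hunit : IsUnit (x * x + 1) := Ideal.mem_jacobson_bot.mp hx x
    have : x * x = 0 := by
      rcases Int.isUnit_iff.mp hunit with h | h <;> nlinarith [mul_self_nonneg x]
    simpa using this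
  · have := hP.isMaximal hP₀
    exact Ideal.jacobson_eq_self_of_isMaximal

theorem finite_of_module_finite_int (k : Type*) [Field k] [Module.Finite ℤ k] : Finite k := by
  obtain ⟨p, hp⟩ := CharP.exists k
  obtain rfl | hp₀ := eq_or_ne p 0
  · have : CharZero k := CharP.charP_to_charZero k
    exact absurd (isField_of_isIntegral_of_isField (algebraMap ℤ k).injective_int
      (Field.toIsField k)) Int.not_isField
  · refine Module.finite_of_fg_torsion k fun x => ?_
    exact ⟨⟨(p : ℤ), mem_nonZeroDivisors_of_ne_zero (by exact_mod_cast hp₀)⟩, by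
      simp [Submonoid.smul_def]⟩

theorem exists_ringHom_finite_field (A : Type*) [CommRing A] [Nontrivial A]
    [hA : Algebra.FiniteType ℤ A] :
    ∃ (k : Type) (_ : Field k) (_ : Finite k), Nonempty (A →+* k) := by
  obtain ⟨I, hI⟩ := Ideal.exists_maximal A
  let _ : Field (A ⧸ I) := Ideal.Quotient.field I
  have : Algebra.FiniteType ℤ (A ⧸ I) :=
    hA.of_surjective (Ideal.Quotient.mkₐ ℤ I) (Ideal.Quotient.mkₐ_surjective ℤ I)
  have := isJacobsonRing_int
  have : Module.Finite ℤ (A ⧸ I) := finite_of_finite_type_of_isJacobsonRing ℤ _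
  have : Finite (A ⧸ I) := finite_of_module_finite_int _
  obtain ⟨p, hp⟩ := CharP.exists (A ⧸ I)
  have : Fact p.Prime := ⟨CharP.char_is_prime (A ⧸ I) p⟩
  -- `FiniteField.Extension` lives in `Type`, whatever the universe of `A`.
  exact ⟨FiniteField.Extension (A ⧸ I) p 1, inferInstance, inferInstance,
    ⟨(algebraMap (A ⧸ I) _).comp (Ideal.Quotient.mk I)⟩⟩

/-- The coefficients generate a finitely generated ring, which maps to a finite field. -/
theorem HasMulRank.exists_finite_field [Nontrivial R] {n t : ℕ} (h : HasMulRank R n t) :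
    ∃ (k : Type) (_ : Field k) (_ : Finite k), HasMulRank k n t := by
  obtain ⟨α, β, γ, h⟩ := h
  let entries (δ : Fin t → Matrix (Fin n) (Fin n) R) : Set R :=
    Set.range fun p : Fin t × Fin n × Fin n => δ p.1 p.2.1 p.2.2
  let s : Set R := entries α ∪ entries β ∪ entries γ
  let A : Subalgebra ℤ R := Algebra.adjoin ℤ s
  have : Algebra.FiniteType ℤ A :=
    (Subalgebra.fg_iff_finiteType _).mp (Subalgebra.fg_def.mpr ⟨s, Set.toFinite _, rfl⟩)
  have hs (x : R) (hx : x ∈ s) : x ∈ A := Algebra.subset_adjoin hx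
  have hA : HasMulRank A n t :=
    ⟨fun μ i j => ⟨α μ i j, hs _ (.inl (.inl ⟨(μ, i, j), rfl⟩))⟩,
      fun μ i j => ⟨β μ i j, hs _ (.inl (.inr ⟨(μ, i, j), rfl⟩))⟩,
      fun μ i j => ⟨γ μ i j, hs _ (.inr ⟨(μ, i, j), rfl⟩)⟩,
      .of_map (f := A.val.toRingHom) Subtype.val_injective h⟩
  obtain ⟨k, _, _, ⟨f⟩⟩ := exists_ringHom_finite_field A
  exact ⟨k, inferInstance, inferInstance, hA.map f⟩

end BilinearRank

/-! ### The exponent of matrix multiplication -/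

section Exponent

/-- The products of two `n × n` matrices over `R` have bilinear algorithms of rank `O(n ^ τ)`: the
analogue of `SquareProductRankO` for commutative rings. -/
def MulRankO (R : Type*) [CommRing R] (τ : ℝ) : Prop :=
  ∃ C : ℝ, ∀ n : ℕ, 1 ≤ n → ∃ t : ℕ, (t : ℝ) ≤ C * (n : ℝ) ^ τ ∧ HasMulRank R n t

variable {R : Type*} [CommRing R] {τ δ : ℝ}

lemma _root_.SquareProductRankO.mulRankO {F : Type*} [Field F] (h : SquareProductRankO F τ) :
    MulRankO F τ :=
  let ⟨C, hC⟩ := h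
  ⟨C, fun n hn => let ⟨t, ht, ⟨P⟩⟩ := hC n hn; ⟨t, ht, .of_algebraicAlgorithm P⟩⟩

lemma HasMulRank.mulRankO {n₀ t₀ : ℕ} (h : HasMulRank R n₀ t₀) (hτ : 0 ≤ τ) (hn₀ : 2 ≤ n₀)
    (ht₀ : (t₀ : ℝ) ≤ (n₀ : ℝ) ^ τ) : MulRankO R τ := by
  refine ⟨(n₀ : ℝ) ^ τ, fun n hn => ?_⟩
  let j := Nat.log n₀ n + 1
  have hle : n ≤ n₀ ^ j := (Nat.lt_pow_succ_log_self hn₀ n).le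
  have hge : n₀ ^ j ≤ n₀ * n := by
    rw [pow_succ']
    exact Nat.mul_le_mul_left _ (Nat.pow_log_le_self _ (by omega))
  refine ⟨t₀ ^ j, ?_, (h.pow j).restrict hle⟩
  calc ((t₀ ^ j : ℕ) : ℝ) = (t₀ : ℝ) ^ j := Nat.cast_pow _ _
    _ ≤ ((n₀ : ℝ) ^ τ) ^ j := by gcongr
    _ = ((n₀ ^ j : ℕ) : ℝ) ^ τ := by
        rw [Nat.cast_pow, ← Real.rpow_mul_natCast (by positivity), mul_comm,
          Real.rpow_natCast_mul (by positivity)]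
    _ ≤ ((n₀ * n : ℕ) : ℝ) ^ τ := by gcongr
    _ = (n₀ : ℝ) ^ τ * (n : ℝ) ^ τ := by
        rw [Nat.cast_mul, Real.mul_rpow (by positivity) (by positivity)]

namespace MulRankO

lemma exists_le_rpow (h : MulRankO R τ) (hδ : 0 < δ) :
    ∃ n t : ℕ, 2 ≤ n ∧ (t : ℝ) ≤ (n : ℝ) ^ (τ + δ) ∧ HasMulRank R n t := by
  obtain ⟨C, hC⟩ := h
  have htends : Filter.Tendsto (fun n : ℕ => (n : ℝ) ^ δ) Filter.atTop Filter.atTop :=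
    (tendsto_rpow_atTop hδ).comp tendsto_natCast_atTop_atTop
  obtain ⟨n, hCn, hn⟩ :=
    ((htends.eventually_ge_atTop C).and (Filter.eventually_ge_atTop 2)).exists
  obtain ⟨t, ht, hr⟩ := hC n (by omega)
  refine ⟨n, t, hn, ?_, hr⟩
  calc (t : ℝ) ≤ C * (n : ℝ) ^ τ := ht
    _ ≤ (n : ℝ) ^ δ * (n : ℝ) ^ τ := by gcongr
    _ = (n : ℝ) ^ (τ + δ) := by rw [← Real.rpow_add (by positivity), add_comm]

lemma two_le [Nontrivial R] (h : MulRankO R τ) : 2 ≤ τ := by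
  refine le_of_forall_pos_le_add fun δ hδ => ?_
  obtain ⟨n, t, hn, ht, hr⟩ := h.exists_le_rpow hδ
  rw [← Real.rpow_le_rpow_left_iff (x := n) (by exact_mod_cast hn)]
  calc (n : ℝ) ^ (2 : ℝ) = (n * n : ℕ) := by rw [Real.rpow_two, sq, Nat.cast_mul]
    _ ≤ t := Nat.cast_le.mpr hr.mul_self_le
    _ ≤ (n : ℝ) ^ (τ + δ) := ht

theorem exists_finite_field [Nontrivial R] (h : MulRankO R τ) (hδ : 0 < δ) :
    ∃ (k : Type) (_ : Field k) (_ : Finite k), MulRankO k (τ + δ) := by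
  obtain ⟨n, t, hn, ht, hr⟩ := h.exists_le_rpow hδ
  obtain ⟨k, _, _, hk⟩ := hr.exists_finite_field
  exact ⟨k, _, ‹_›, hk.mulRankO (by linarith [h.two_le]) hn ht⟩

end MulRankO

variable (F : Type*) [Field F]

lemma nonempty_algebraicAlgorithm (n : ℕ) : Nonempty (AlgebraicAlgorithm F n n (n * (n * n))) := by
  let e : Fin (n * (n * n)) ≃ Fin n × Fin n × Fin n :=
    finProdFinEquiv.symm.trans ((Equiv.refl _).prodCongr finProdFinEquiv.symm)
  refine ⟨⟨fun i j μ => if (e μ).1 = i ∧ (e μ).2.1 = j then 1 else 0,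
    fun i j μ => if (e μ).2.2 = i ∧ (e μ).2.1 = j then 1 else 0,
    fun i j μ => if (e μ).1 = i ∧ (e μ).2.2 = j then 1 else 0, fun A B i j => ?_⟩⟩
  rw [← e.symm.sum_comp, Matrix.mul_apply]
  simp [Fintype.sum_prod_type, ite_and, Finset.sum_ite_irrel]

lemma squareProductRankO_of_three_le (hτ : 3 ≤ τ) : SquareProductRankO F τ := by
  refine ⟨1, fun n hn => ⟨n * (n * n), ?_, nonempty_algebraicAlgorithm F n⟩⟩
  calc ((n * (n * n) : ℕ) : ℝ) = (n : ℝ) ^ (3 : ℝ) := by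
        rw [show (3 : ℝ) = (3 : ℕ) by norm_num, Real.rpow_natCast]
        push_cast
        ring
    _ ≤ (n : ℝ) ^ τ := Real.rpow_le_rpow_of_exponent_le (by exact_mod_cast hn) hτ
    _ = 1 * (n : ℝ) ^ τ := (one_mul _).symm

lemma nonempty_setOf_squareProductRankO :
    {τ : ℝ | ∀ ε : ℝ, 0 < ε → SquareProductRankO F (τ + ε)}.Nonempty :=
  ⟨3, fun _ hε => squareProductRankO_of_three_le F (by linarith)⟩

lemma two_le_omegaExponent : 2 ≤ omegaExponent F :=
  le_csInf (nonempty_setOf_squareProductRankO F) fun _ h =>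
    le_of_forall_pos_le_add fun ε hε => (h ε hε).mulRankO.two_le

lemma squareProductRankO_omegaExponent_add (hδ : 0 < δ) :
    SquareProductRankO F (omegaExponent F + δ) := by
  obtain ⟨τ, hτ, hlt⟩ := exists_lt_of_csInf_lt (nonempty_setOf_squareProductRankO F)
    (lt_add_of_pos_right (omegaExponent F) hδ)
  simpa using hτ _ (sub_pos.mpr hlt)

end Exponent

/-! ### Block matrices -/

section BlockMultiplication

open Matrix

variable {K : Type*} [CommRing K] {ν ι σ τ : Type*} (e : ν ↪ ι × σ)

/-- The extension by zero of the matrix `A` along the embedding `e`, which places every index into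
a block `i : ι` at a position `a : σ`. -/
noncomputable def padBlocks (A : Matrix ν ν K) : Matrix (ι × σ) (ι × σ) K :=
  of fun x y => Function.extend (Prod.map e e) (Function.uncurry A) (fun _ => 0) (x, y)

/-- The linear form with coefficients `α` in the blocks of `M`. -/
def blockForm [Fintype ι] (α : Matrix ι ι K) (M : Matrix (ι × σ) (ι × σ) K) : Matrix σ σ K :=
  of fun a b => ∑ p : ι × ι, α p.1 p.2 * M (p.1, a) (p.2, b)

lemma padBlocks_apply (A : Matrix ν ν K) (i j : ν) : padBlocks e A (e i) (e j) = A i j :=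
  (e.injective.prodMap e.injective).extend_apply (Function.uncurry A) (fun _ => 0) (i, j)

lemma padBlocks_apply_eq_zero (A : Matrix ν ν K) {x y : ι × σ}
    (h : ¬∃ p : ν × ν, e p.1 = x ∧ e p.2 = y) : padBlocks e A x y = 0 :=
  Function.extend_apply' (f := Prod.map e e) (Function.uncurry A) (fun _ => 0) (x, y)
    fun ⟨p, hp⟩ => h ⟨p, Prod.mk_inj.mp hp⟩

variable [Fintype ν] [Fintype ι] [Fintype σ]

lemma padBlocks_mul_padBlocks_apply (A B : Matrix ν ν K) (i j : ν) :
    (padBlocks e A * padBlocks e B) (e i) (e j) = (A * B) i j := by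
  rw [Matrix.mul_apply, Matrix.mul_apply]
  refine (Fintype.sum_of_injective e e.injective _ _ (fun x hx => ?_) fun k => ?_).symm
  · rw [padBlocks_apply_eq_zero e A fun ⟨p, _, hp⟩ => hx ⟨p.2, hp⟩, zero_mul]
  · rw [padBlocks_apply, padBlocks_apply]

lemma BrentEquations.mul_apply_eq_sum_blockForm [DecidableEq ι] [Fintype τ]
    {α β γ : τ → Matrix ι ι K} (h : BrentEquations α β γ) (A B : Matrix ν ν K) (i j : ν) :
    (A * B) i j = ∑ μ, γ μ (e i).1 (e j).1 *
      (blockForm (α μ) (padBlocks e A) * blockForm (β μ) (padBlocks e B)) (e i).2 (e j).2 := by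
  classical
  let φ := (compRingEquiv ι σ K).symm
  have hform (δ : Matrix ι ι K) (M : Matrix (ι × σ) (ι × σ) K) :
      ∑ p : ι × ι, δ p.1 p.2 • φ M p.1 p.2 = blockForm δ M := by
    ext a b
    simp [φ, blockForm, Matrix.sum_apply]
  calc (A * B) i j
      = (φ (padBlocks e A) * φ (padBlocks e B)) (e i).1 (e j).1 (e i).2 (e j).2 := by
        rw [← padBlocks_mul_padBlocks_apply e A B, ← map_mul]
        rfl
    _ = _ := by
        rw [h.mul_apply]
        simp only [hform, Matrix.sum_apply, Matrix.smul_apply, smul_eq_mul]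

end BlockMultiplication

/-! ### Distributed matrix multiplication -/

section MatMul

variable {n : ℕ} {S : Type} {T w : ℕ} {κ κ' : Fin n → Setoid (Input n S)} {K : Type*}

/-- Every node knows its row of the matrix `A`, which depends on the input. -/
def KnowsRows (κ : Fin n → Setoid (Input n S)) (A : Input n S → Matrix (Fin n) (Fin n) K) : Prop :=
  ∀ v, Knows (κ v) fun a => A a v

lemma KnowsRows.mono {A : Input n S → Matrix (Fin n) (Fin n) K} (h : KnowsRows κ A)
    (hκ : κ' ≤ κ) : KnowsRows κ' A :=
  fun v => (h v).mono (hκ v)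

lemma card_row_le {L : ℕ} (hL : 1 ≤ L) (v : Fin n) :
    Nat.card {p : Fin n × Fin n // p.1 = v} ≤ L * n :=
  (card_fiber_le (g := Prod.snd) Function.injective_id v).trans
    (by simpa using Nat.le_mul_of_pos_left n hL)

variable [CommRing K] {m s t L : ℕ} (e : Fin n ↪ Fin m × Fin s)
  (g : Fin s × Fin s ↪ Fin L × Fin n)

lemma Knows.blockForm {Ω : Type*} {r : Setoid Ω} (α : Matrix (Fin m) (Fin m) K)
    {A : Ω → Matrix (Fin n) (Fin n) K} (x : Fin s × Fin s)
    (h : ∀ p : Fin n × Fin n, ((e p.1).2, (e p.2).2) = x → Knows r fun ω => A ω p.1 p.2) :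
    Knows r fun ω => blockForm α (padBlocks e (A ω)) x.1 x.2 := by
  refine Knows.sum fun q _ => Knows.comp (φ := (α q.1 q.2 * ·)) ?_
  by_cases hex : ∃ p : Fin n × Fin n, e p.1 = (q.1, x.1) ∧ e p.2 = (q.2, x.2)
  · obtain ⟨p, hp₁, hp₂⟩ := hex
    simpa only [← hp₁, ← hp₂, padBlocks_apply] using h p (by rw [hp₁, hp₂])
  · simpa only [padBlocks_apply_eq_zero e _ hex] using Knows.const _

lemma card_entries_le (hL : L * (m * m) ≤ 5 * n) (v : Fin n) :
    Nat.card {p : Fin n × Fin n // (g ((e p.1).2, (e p.2).2)).2 = v} ≤ 5 * n := by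
  refine (card_fiber_le (f := fun p : Fin n × Fin n => (g ((e p.1).2, (e p.2).2)).2)
    (g := fun p => ((g ((e p.1).2, (e p.2).2)).1, (e p.1).1, (e p.2).1)) (fun p q hpq => ?_)
    v).trans (by simpa using hL)
  simp only [Prod.mk.injEq] at hpq
  obtain ⟨hg₂, hg₁, he₁, he₂⟩ := hpq
  obtain ⟨ha, hb⟩ := Prod.mk_inj.mp (g.injective (Prod.ext hg₁ hg₂))
  exact Prod.ext (e.injective (Prod.ext he₁ ha)) (e.injective (Prod.ext he₂ hb))

lemma card_positions_le (ht : t ≤ n) (v : Fin n) :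
    Nat.card {x : (Fin s × Fin s) × Fin t // (g x.1).2 = v} ≤ L * n := by
  refine (card_fiber_le (f := fun x : (Fin s × Fin s) × Fin t => (g x.1).2)
    (g := fun x => ((g x.1).1, x.2)) (fun x y hxy => ?_) v).trans
    (by simpa using Nat.mul_le_mul_left L ht)
  simp only [Prod.mk.injEq] at hxy
  exact Prod.ext (g.injective (Prod.ext hxy.2.1 hxy.1)) hxy.2.2

include g in
lemma card_products_le (ht : t ≤ n) (v : Fin n) :
    Nat.card {x : (Fin s × Fin s) × Fin t // x.2.castLE ht = v} ≤ L * n := by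
  refine (card_fiber_le (f := fun x : (Fin s × Fin s) × Fin t => x.2.castLE ht)
    (g := fun x => g x.1) (fun x y hxy => ?_) v).trans (by simp)
  simp only [Prod.mk.injEq] at hxy
  exact Prod.ext (g.injective hxy.2) (Fin.castLE_injective ht hxy.1)

include g in
/-- Node `(g x).2` collects the entries at position `x` of all blocks, and node `μ` then receives
the `μ`-th linear form in the blocks. -/
lemma Reachable.blockForms (h : Reachable T κ) (enc : K ↪ (Fin w → Message n)) (ht : t ≤ n)
    (hL : L * (m * m) ≤ 5 * n) (α : Fin t → Matrix (Fin m) (Fin m) K)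
    {A : Input n S → Matrix (Fin n) (Fin n) K} (hA : KnowsRows κ A) :
    ∃ κ' ≤ κ, Reachable (T + 20 * w + 4 * (L * w)) κ' ∧ ∀ μ a b,
      Knows (κ' (Fin.castLE ht μ))
        fun ω => CongestedClique.blockForm (α μ) (padBlocks e (A ω)) a b := by
  obtain ⟨κ₁, hκ₁, h₁, hentry⟩ := h.route enc (card_row_le (by norm_num)) (card_entries_le e g hL)
    (val := fun p ω => A ω p.1 p.2) fun p => (hA p.1).comp fun x => x p.2
  obtain ⟨κ₂, hκ₂, h₂, hform⟩ := h₁.route enc (card_positions_le g ht) (card_products_le g ht)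
    (val := fun x ω => CongestedClique.blockForm (α x.2) (padBlocks e (A ω)) x.1.1 x.1.2)
    fun x => Knows.blockForm e (α x.2) x.1 fun p hp => hp ▸ hentry p
  refine ⟨κ₂, hκ₂.trans hκ₁, ?_, fun μ a b => hform ((a, b), μ)⟩
  convert h₂ using 1
  ring

include e g in
lemma Reachable.matMul_of_embedding (h : Reachable T κ) (enc : K ↪ (Fin w → Message n))
    (hr : HasMulRank K m t) (ht : t ≤ n) (hL : L * (m * m) ≤ 5 * n)
    {A B : Input n S → Matrix (Fin n) (Fin n) K} (hA : KnowsRows κ A) (hB : KnowsRows κ B) :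
    ∃ κ' ≤ κ, Reachable (T + (60 * w + 12 * (L * w))) κ' ∧ KnowsRows κ' fun a => A a * B a := by
  obtain ⟨α, β, γ, hBrent⟩ := hr
  obtain ⟨κ₁, hκ₁, h₁, hα⟩ := h.blockForms e g enc ht hL α hA
  obtain ⟨κ₂, hκ₂, h₂, hβ⟩ := h₁.blockForms e g enc ht hL β (hB.mono hκ₁)
  let product (μ : Fin t) (a : Input n S) : Matrix (Fin s) (Fin s) K :=
    blockForm (α μ) (padBlocks e (A a)) * blockForm (β μ) (padBlocks e (B a))
  have hproduct (x : (Fin s × Fin s) × Fin t) :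
      Knows (κ₂ (x.2.castLE ht)) fun a => product x.2 a x.1.1 x.1.2 := by
    simp only [product, Matrix.mul_apply]
    exact Knows.sum fun c _ => ((hα x.2 x.1.1 c).mono (hκ₂ _)).comp₂ (hβ x.2 c x.1.2) (· * ·)
  obtain ⟨κ₃, hκ₃, h₃, hback⟩ := h₂.route enc (card_products_le g ht) (card_positions_le g ht)
    hproduct
  have hentry (p : Fin n × Fin n) :
      Knows (κ₃ (g ((e p.1).2, (e p.2).2)).2) fun a => (A a * B a) p.1 p.2 := by
    simp only [hBrent.mul_apply_eq_sum_blockForm e]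
    exact Knows.sum fun μ _ => (hback (((e p.1).2, (e p.2).2), μ)).comp (γ μ _ _ * ·)
  obtain ⟨κ₄, hκ₄, h₄, hrow⟩ := h₃.route enc (card_entries_le e g hL) (card_row_le (by norm_num))
    hentry
  refine ⟨κ₄, hκ₄.trans (hκ₃.trans (hκ₂.trans hκ₁)), ?_, fun v => Knows.pi fun j => hrow (v, j)⟩
  convert h₄ using 1
  ring

/-- A number of rounds in which `n` nodes can multiply matrices over a ring whose elements are
encoded in `w` messages, with a bilinear algorithm of rank at most `n` for `m × m` matrices. -/
def matMulRounds (n m w : ℕ) : ℕ :=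
  72 * w * ((n / m + 1) ^ 2 / n + 1)

lemma blockSize_mul_le (hmn : m ≤ n) : m * (n / m + 1) ≤ 2 * n :=
  calc m * (n / m + 1) = m * (n / m) + m := Nat.mul_succ _ _
    _ ≤ n + n := Nat.add_le_add (Nat.mul_div_le n m) hmn
    _ = 2 * n := (two_mul n).symm

lemma sq_blockSize_div_mul_le (hmn : m * m ≤ n) :
    ((n / m + 1) ^ 2 / n + 1) * (m * m) ≤ 5 * n := by
  obtain rfl | hn := Nat.eq_zero_or_pos n
  · simpa using hmn
  have hmain : (n / m + 1) ^ 2 / n * (m * m) ≤ 4 * n := by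
    refine Nat.le_of_mul_le_mul_right ?_ hn
    calc (n / m + 1) ^ 2 / n * (m * m) * n = (n / m + 1) ^ 2 / n * n * (m * m) := by ring
      _ ≤ (n / m + 1) ^ 2 * (m * m) := Nat.mul_le_mul_right _ (Nat.div_mul_le_self _ _)
      _ = (m * (n / m + 1)) ^ 2 := by ring
      _ ≤ (2 * n) ^ 2 :=
        Nat.pow_le_pow_left (blockSize_mul_le ((Nat.le_mul_self m).trans hmn)) 2
      _ = 4 * n * n := by ring
  rw [add_one_mul]
  omega

theorem Reachable.matMul [Nontrivial K] (h : Reachable T κ) (enc : K ↪ (Fin w → Message n))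
    (hr : HasMulRank K m t) (hm : 1 ≤ m) (ht : t ≤ n)
    {A B : Input n S → Matrix (Fin n) (Fin n) K} (hA : KnowsRows κ A) (hB : KnowsRows κ B) :
    ∃ κ' ≤ κ, Reachable (T + matMulRounds n m w) κ' ∧ KnowsRows κ' fun a => A a * B a := by
  have hmn : m * m ≤ n := hr.mul_self_le.trans ht
  have hn : 0 < n := (Nat.mul_pos hm hm).trans_le hmn
  let s := n / m + 1
  let L := s ^ 2 / n + 1
  have hns : n ≤ m * s := (Nat.lt_mul_div_succ n hm).le
  have hsL : s * s ≤ L * n := by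
    rw [← sq, mul_comm L]
    exact (Nat.lt_mul_div_succ (s ^ 2) hn).le
  obtain ⟨e⟩ : Nonempty (Fin n ↪ Fin m × Fin s) :=
    Function.Embedding.nonempty_of_card_le (by simpa using hns)
  obtain ⟨g⟩ : Nonempty (Fin s × Fin s ↪ Fin L × Fin n) :=
    Function.Embedding.nonempty_of_card_le (by simpa using hsL)
  obtain ⟨κ₁, hκ₁, h₁, hAB⟩ := h.matMul_of_embedding e g enc hr ht
    (sq_blockSize_div_mul_le hmn) hA hB
  obtain ⟨κ₂, hκ₂, h₂⟩ := h₁.wait (T' := T + matMulRounds n m w) (by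
    have : w ≤ L * w := Nat.le_mul_of_pos_left w (Nat.succ_pos _)
    have : matMulRounds n m w = 72 * (L * w) := by simp only [matMulRounds, L, s]; ring
    omega)
  exact ⟨κ₂, hκ₂.trans hκ₁, h₂, hAB.mono hκ₂⟩

end MatMul

/-! ### Alternating matrices and matchings -/

section Matching

variable {V : Type*} [Finite V] {G : SimpleGraph V}

lemma ncard_verts_of_isMatching {M : G.Subgraph} (hM : M.IsMatching) :
    M.verts.ncard = 2 * M.edgeSet.ncard := by
  classical
  have := Fintype.ofFinite V
  have hdeg (v : V) : M.spanningCoe.degree v = if v ∈ M.verts then 1 else 0 := by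
    rw [SimpleGraph.Subgraph.degree_spanningCoe]
    split_ifs with hv
    · exact SimpleGraph.Subgraph.isMatching_iff_forall_degree.mp hM v hv
    · exact SimpleGraph.Subgraph.degree_of_notMem_verts hv
  calc M.verts.ncard = ∑ v, M.spanningCoe.degree v := by
        simp only [hdeg, Finset.sum_boole, Nat.cast_id, ← Set.ncard_coe_finset,
          Finset.coe_filter_univ, Set.ofPred_mem_eq]
    _ = 2 * M.spanningCoe.edgeFinset.card := M.spanningCoe.sum_degrees_eq_twice_card_edges
    _ = 2 * M.edgeSet.ncard := by
        rw [← M.edgeSet_spanningCoe, ← SimpleGraph.coe_edgeFinset, Set.ncard_coe_finset]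

lemma two_mul_ncard_edgeSet_le {M : G.Subgraph} (hM : M.IsMatching) :
    2 * M.edgeSet.ncard ≤ Nat.card V :=
  ncard_verts_of_isMatching hM ▸ Set.ncard_le_card M.verts

lemma bddAbove_ncard_edgeSet :
    BddAbove {k : ℕ | ∃ M : G.Subgraph, M.IsMatching ∧ M.edgeSet.ncard = k} := by
  refine ⟨Nat.card V, ?_⟩
  rintro k ⟨M, hM, rfl⟩
  have := two_mul_ncard_edgeSet_le hM
  omega

lemma ncard_edgeSet_le_matchingNumber {M : G.Subgraph} (hM : M.IsMatching) :
    M.edgeSet.ncard ≤ matchingNumber G :=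
  le_csSup bddAbove_ncard_edgeSet ⟨M, hM, rfl⟩

variable (G) in
lemma exists_isMatching_ncard_eq_matchingNumber :
    ∃ M : G.Subgraph, M.IsMatching ∧ M.edgeSet.ncard = matchingNumber G :=
  Nat.sSup_mem (s := {k | ∃ M : G.Subgraph, M.IsMatching ∧ M.edgeSet.ncard = k})
    ⟨_, ⊥, fun _ hv => hv.elim, rfl⟩ bddAbove_ncard_edgeSet

omit [Finite V] in
lemma exists_isMatching_of_comap {W : Type*} (f : W ↪ V) {M : (G.comap f).Subgraph}
    (hM : M.IsPerfectMatching) : ∃ N : G.Subgraph, N.IsMatching ∧ N.verts = Set.range f :=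
  ⟨M.map (SimpleGraph.Embedding.comap f G).toHom, hM.1.map _ f.injective, by
    rw [SimpleGraph.Subgraph.map_verts, hM.2.verts_eq_univ]
    exact Set.image_univ⟩

omit [Finite V] in
lemma exists_isPerfectMatching_of_adj {i j : V} (h : G.Adj i j)
    {M : (G.comap (Subtype.val : {v // v ≠ i ∧ v ≠ j} → V)).Subgraph}
    (hM : M.IsPerfectMatching) : ∃ N : G.Subgraph, N.IsPerfectMatching := by
  obtain ⟨N, hN, hverts⟩ := exists_isMatching_of_comap (Function.Embedding.subtype _) hM
  have hij := SimpleGraph.Subgraph.IsMatching.subgraphOfAdj h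
  simp only [Function.Embedding.coe_subtype, Subtype.range_coe_subtype] at hverts
  refine ⟨N ⊔ G.subgraphOfAdj h, hN.sup hij ?_, fun v => ?_⟩
  · rw [hN.support_eq_verts, hij.support_eq_verts, hverts, Set.disjoint_left]
    rintro v ⟨hi, hj⟩ (rfl | rfl) <;> contradiction
  · rw [SimpleGraph.Subgraph.verts_sup, hverts]
    by_cases hv : v ≠ i ∧ v ≠ j
    · exact .inl hv
    · exact .inr (by rw [not_and_or, not_not, not_not] at hv; exact hv)

end Matching

section Alternating

open Matrix

variable {V W R K : Type*} [CommRing R] [Field K]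

/-- The matrix `A` is alternating: it is skew-symmetric and, which is a further condition in
characteristic two, its diagonal vanishes. -/
structure IsAlternating (A : Matrix V V R) : Prop where
  apply_self : ∀ i, A i i = 0
  transpose_eq : Aᵀ = -A

namespace IsAlternating

lemma apply_swap {A : Matrix V V R} (hA : IsAlternating A) (i j : V) : A j i = -A i j :=
  congrFun₂ hA.transpose_eq i j

lemma submatrix {A : Matrix V V R} (hA : IsAlternating A) (f : W → V) :
    IsAlternating (A.submatrix f f) :=
  ⟨fun i => hA.apply_self (f i), ext fun i j => hA.apply_swap (f i) (f j)⟩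

variable [Fintype V]

lemma dotProduct_mulVec_self {A : Matrix V V R} (hA : IsAlternating A) (y : V → R) :
    y ⬝ᵥ A *ᵥ y = 0 := by
  calc y ⬝ᵥ A *ᵥ y = ∑ p : V × V, y p.1 * (A p.1 p.2 * y p.2) := by
        simp only [dotProduct, mulVec, Finset.mul_sum, Fintype.sum_prod_type]
    _ = 0 := by
        refine Finset.sum_involution (fun p _ => p.swap) (fun p _ => ?_) (fun p _ hp hswap => hp ?_)
          (fun p _ => Finset.mem_univ _) (fun p _ => p.swap_swap)
        · simp only [Prod.fst_swap, Prod.snd_swap, hA.apply_swap p.1 p.2]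
          ring
        · rw [← congrArg Prod.fst hswap, Prod.fst_swap, hA.apply_self, zero_mul, mul_zero]

lemma mul_mul_transpose {A : Matrix V V R} (hA : IsAlternating A) (P : Matrix W V R) :
    IsAlternating (P * A * Pᵀ) where
  apply_self i := by
    rw [Matrix.mul_assoc]
    exact hA.dotProduct_mulVec_self (P i)
  transpose_eq := by
    simp only [transpose_mul, transpose_transpose, hA.transpose_eq, Matrix.mul_neg, Matrix.neg_mul,
      Matrix.mul_assoc]

variable [DecidableEq V]

lemma inv {A : Matrix V V R} (hA : IsAlternating A) (hdet : IsUnit A.det) : IsAlternating A⁻¹ := by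
  have hAinv : A⁻¹ᵀ * A * A⁻¹ᵀᵀ = A⁻¹ᵀ := by
    rw [transpose_transpose, Matrix.mul_assoc, mul_nonsing_inv A hdet, Matrix.mul_one]
  have h := hAinv ▸ hA.mul_mul_transpose A⁻¹ᵀ
  exact ⟨h.apply_self, by rw [← neg_eq_iff_eq_neg, ← h.transpose_eq, transpose_transpose]⟩

/-- A vector supported off `i, j` that `A` maps to `a eᵢ + b eⱼ` has coordinates `0 = b (A⁻¹)ᵢⱼ` and
`0 = a (A⁻¹)ⱼᵢ`. -/
lemma det_submatrix_ne_zero {A : Matrix V V K} (hA : IsAlternating A) (hdet : A.det ≠ 0) {i j : V}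
    (hij : A⁻¹ j i ≠ 0) :
    (A.submatrix (Subtype.val : {v // v ≠ i ∧ v ≠ j} → V) Subtype.val).det ≠ 0 := by
  intro hzero
  obtain ⟨y', hy', hAy'⟩ := exists_mulVec_eq_zero_iff.mpr hzero
  have hinv := hA.inv hdet.isUnit
  let y : V → K := Function.extend Subtype.val y' 0
  have hy_val (v : {v // v ≠ i ∧ v ≠ j}) : y v = y' v :=
    Subtype.val_injective.extend_apply y' 0 v
  have hy_zero (v : V) (hv : v ∉ Set.range (Subtype.val : {v // v ≠ i ∧ v ≠ j} → V)) : y v = 0 :=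
    Function.extend_apply' y' (0 : V → K) v hv
  have hAy (v : {v // v ≠ i ∧ v ≠ j}) : (A *ᵥ y) v = 0 := by
    refine Eq.trans (Fintype.sum_of_injective Subtype.val Subtype.val_injective _ _
      (fun u hu => ?_) fun u => ?_).symm (congrFun hAy' v)
    · rw [hy_zero u hu, mul_zero]
    · exact congrArg (A v u * ·) (hy_val u).symm
  have hne : i ≠ j := by
    rintro rfl
    exact hij (hinv.apply_self i)
  have hy (v : V) : y v = A⁻¹ v i * (A *ᵥ y) i + A⁻¹ v j * (A *ᵥ y) j := by
    calc y v = (A⁻¹ *ᵥ A *ᵥ y) v := by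
          rw [mulVec_mulVec, nonsing_inv_mul A hdet.isUnit, one_mulVec]
      _ = ∑ u ∈ {i, j}, A⁻¹ v u * (A *ᵥ y) u := by
          refine (Finset.sum_subset (Finset.subset_univ _) fun u _ hu => ?_).symm
          rw [hAy ⟨u, by simpa using hu⟩, mul_zero]
      _ = _ := Finset.sum_pair hne
  have hj : (A *ᵥ y) j = 0 := by
    have : y i = 0 := hy_zero _ (by simp)
    rw [hy i, hinv.apply_self, zero_mul, zero_add, hinv.apply_swap j i] at this
    exact (mul_eq_zero.mp this).resolve_left (neg_ne_zero.mpr hij)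
  have hi : (A *ᵥ y) i = 0 := by
    have : y j = 0 := hy_zero _ (by simp)
    rw [hy j, hinv.apply_self, zero_mul, add_zero] at this
    exact (mul_eq_zero.mp this).resolve_left hij
  refine hy' (funext fun v => ?_)
  calc y' v = y v := (hy_val v).symm
    _ = 0 := by rw [hy, hi, hj, mul_zero, mul_zero, add_zero]

theorem exists_isPerfectMatching {V : Type*} [Fintype V] [DecidableEq V] {A : Matrix V V K}
    (hA : IsAlternating A) (hdet : A.det ≠ 0) {G : SimpleGraph V}
    (hG : ∀ i j, A i j ≠ 0 → G.Adj i j) : ∃ M : G.Subgraph, M.IsPerfectMatching := by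
  induction hV : Fintype.card V using Nat.strong_induction_on generalizing V with | _ k ih
  cases isEmpty_or_nonempty V with
  | inl _ => exact ⟨⊥, fun _ hv => hv.elim, isEmptyElim⟩
  | inr hne =>
    obtain ⟨i⟩ := hne
    obtain ⟨j, hij⟩ : ∃ j, A i j * A⁻¹ j i ≠ 0 := by
      by_contra! hall
      have := congrFun₂ (mul_nonsing_inv A hdet.isUnit) i i
      rw [mul_apply, Finset.sum_eq_zero fun j _ => hall j, one_apply_eq] at this
      exact zero_ne_one this
    obtain ⟨M, hM⟩ := ih _ (hV ▸ Fintype.card_subtype_lt (x := i) (by simp))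
      (hA.submatrix (Subtype.val : {v // v ≠ i ∧ v ≠ j} → V))
      (hA.det_submatrix_ne_zero hdet (right_ne_zero_of_mul hij))
      (G := G.comap Subtype.val) (fun u v => hG u v) rfl
    exact exists_isPerfectMatching_of_adj (hG i j (left_ne_zero_of_mul hij)) hM

end IsAlternating

lemma exists_mul_submatrix_eq [Finite V] [Fintype W] (A : Matrix V W K) :
    ∃ (b : Fin A.rank → V) (C : Matrix V (Fin A.rank) K), C * A.submatrix b id = A := by
  have hbasis := Submodule.exists_fun_fin_finrank_span_eq K (Set.range A.row)
  rw [← A.rank_eq_finrank_span_row] at hbasis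
  obtain ⟨f, hf, hspan, -⟩ := hbasis
  choose b hb using hf
  have hrow (v : V) : ∃ c : Fin A.rank → K, ∑ k, c k • f k = A.row v := by
    rw [← Submodule.mem_span_range_iff_exists_fun, hspan]
    exact Submodule.subset_span (Set.mem_range_self v)
  choose C hC using hrow
  refine ⟨b, of C, ext fun v w => ?_⟩
  simpa [mul_apply, ← hb] using congrFun (hC v) w

lemma det_ne_zero_of_card_le_rank [Fintype V] [DecidableEq V] {A : Matrix V V K}
    (h : Fintype.card V ≤ A.rank) : A.det ≠ 0 := by
  rw [rank_eq_finrank_span_row] at h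
  rw [← isUnit_iff_ne_zero, ← isUnit_iff_isUnit_det, ← linearIndependent_rows_iff_isUnit]
  exact linearIndependent_iff_card_le_finrank_span.mpr h

variable [Fintype V]

lemma IsAlternating.exists_det_submatrix_ne_zero {A : Matrix V V K} (hA : IsAlternating A) :
    ∃ b : Fin A.rank ↪ V, (A.submatrix b b).det ≠ 0 := by
  obtain ⟨b, C, hC⟩ := exists_mul_submatrix_eq A
  have hcols : A.submatrix b b * Cᵀ = A.submatrix b id := by
    calc A.submatrix b b * Cᵀ = -((C * A.submatrix b id)ᵀ.submatrix b id) := by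
          rw [transpose_mul, transpose_submatrix, hA.transpose_eq]
          ext k v
          simp [mul_apply]
      _ = A.submatrix b id := by
          rw [hC, hA.transpose_eq, submatrix_neg, Pi.neg_apply, Pi.neg_apply, neg_neg]
  have hdet : (A.submatrix b b).det ≠ 0 := by
    refine det_ne_zero_of_card_le_rank ?_
    calc Fintype.card (Fin A.rank) = (C * (A.submatrix b b * Cᵀ)).rank := by
          rw [hcols, hC, Fintype.card_fin]
      _ ≤ (A.submatrix b b).rank := (rank_mul_le_right _ _).trans (rank_mul_le_left _ _)
  refine ⟨⟨b, fun k l hkl => ?_⟩, hdet⟩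
  by_contra hne
  exact hdet (det_zero_of_row_eq hne (funext fun m => by simp only [submatrix_apply, hkl]))

theorem IsAlternating.rank_le_two_mul_matchingNumber {A : Matrix V V K} (hA : IsAlternating A)
    {G : SimpleGraph V} (hG : ∀ i j, A i j ≠ 0 → G.Adj i j) :
    A.rank ≤ 2 * matchingNumber G := by
  obtain ⟨b, hdet⟩ := hA.exists_det_submatrix_ne_zero
  obtain ⟨M, hM⟩ := (hA.submatrix b).exists_isPerfectMatching hdet (G := G.comap b)
    fun i j => hG (b i) (b j)
  obtain ⟨N, hN, hverts⟩ := exists_isMatching_of_comap b hM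
  calc A.rank = N.verts.ncard := by
        rw [hverts, ← Set.image_univ, Set.ncard_image_of_injective _ b.injective, Set.ncard_univ,
          Nat.card_fin]
    _ = 2 * N.edgeSet.ncard := ncard_verts_of_isMatching hN
    _ ≤ 2 * matchingNumber G := Nat.mul_le_mul_left 2 (ncard_edgeSet_le_matchingNumber hN)

end Alternating

/-! ### Hankel matrices -/

section Hankel

open Matrix

variable {V R R' K : Type*} [Fintype V] [DecidableEq V] [CommRing R] [CommRing R'] [Field K]

/-- The `r × r` Hankel matrix of the sequence `1ᵀ M ^ k 1`, where `k ≥ 1`. -/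
def hankel (r : ℕ) (M : Matrix V V R) : Matrix (Fin r) (Fin r) R :=
  of fun i j => 1 ⬝ᵥ M ^ (i + j + 1 : ℕ) *ᵥ 1

lemma hankel_map (f : R →+* R') (r : ℕ) (M : Matrix V V R) :
    (hankel r M).map f = hankel r (M.map f) := by
  have hpow (k : ℕ) : M.map f ^ k = (M ^ k).map f := (map_pow f.mapMatrix M k).symm
  ext i j
  simp [hankel, hpow, mulVec, dotProduct]

lemma rank_hankel_le (r : ℕ) (M : Matrix V V K) : (hankel r M).rank ≤ M.rank := by
  let P : Matrix (Fin r) V K := of fun i => 1 ᵥ* M ^ (i : ℕ)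
  let Q : Matrix (Fin r) V K := of fun j => M ^ (j : ℕ) *ᵥ 1
  have h : hankel r M = P * M * Qᵀ := by
    ext i j
    calc 1 ⬝ᵥ M ^ (i + j + 1 : ℕ) *ᵥ 1 = 1 ᵥ* M ^ (i : ℕ) ᵥ* M ⬝ᵥ M ^ (j : ℕ) *ᵥ 1 := by
          rw [vecMul_vecMul, ← pow_succ, ← dotProduct_mulVec, mulVec_mulVec, ← pow_add,
            add_right_comm]
      _ = (P * M * Qᵀ) i j := rfl
  rw [h]
  exact (rank_mul_le_left _ _).trans (rank_mul_le_right _ _)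

lemma le_rank_hankel {r s : ℕ} {M : Matrix V V K} (hrs : r ≤ s) (h : (hankel r M).det ≠ 0) :
    r ≤ (hankel s M).rank := by
  calc r = (hankel r M).rank := by rw [rank_of_det_ne_zero h, Fintype.card_fin]
    _ = ((hankel s M).submatrix (Fin.castLE hrs) (Fin.castLE hrs)).rank := rfl
    _ ≤ (hankel s M).rank := rank_submatrix_le _ _ _

lemma det_hankel_diagonal_ne_zero {r : ℕ} {d : V → K} (φ : Fin r ↪ V)
    (hd : ∀ v, v ∈ Set.range φ ↔ d v ≠ 0) (hinj : Function.Injective (d ∘ φ)) :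
    (hankel r (diagonal d)).det ≠ 0 := by
  have h : hankel r (diagonal d) =
      (vandermonde (d ∘ φ))ᵀ * (diagonal (d ∘ φ) * vandermonde (d ∘ φ)) := by
    ext i j
    calc hankel r (diagonal d) i j = ∑ v, d v ^ (i + j + 1 : ℕ) := by
          simp [hankel, diagonal_pow, mulVec_diagonal, dotProduct]
      _ = ∑ k, d (φ k) ^ (i + j + 1 : ℕ) := by
          refine (Fintype.sum_of_injective φ φ.injective _ _ (fun v hv => ?_) fun _ => rfl).symm
          rw [hd, not_not] at hv
          rw [hv, zero_pow (Nat.succ_ne_zero _)]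
      _ = _ := by
          rw [mul_apply]
          simp only [transpose_apply, diagonal_mul, vandermonde_apply, Function.comp_apply]
          exact Finset.sum_congr rfl fun k _ => by ring
  have hvand := det_vandermonde_ne_zero_iff.mpr hinj
  rw [h, det_mul, det_mul, det_transpose, det_diagonal]
  exact mul_ne_zero hvand (mul_ne_zero (Finset.prod_ne_zero_iff.mpr fun k _ =>
    (hd (φ k)).mp (Set.mem_range_self k)) hvand)

end Hankel

/-! ### The Tutte matrix -/

section Tutte

open Matrix

variable {V R R' K : Type*} [LinearOrder V] [CommRing R] [CommRing R'] [Field K]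

open Classical in
/-- The part above the diagonal of the Tutte matrix of `G` with weights `x`. -/
noncomputable def upperTutte (G : SimpleGraph V) (x : Matrix V V R) : Matrix V V R :=
  of fun i j => if i < j ∧ G.Adj i j then x i j else 0

/-- The Tutte matrix of `G` with weights `x`. -/
noncomputable def tutte (G : SimpleGraph V) (x : Matrix V V R) : Matrix V V R :=
  upperTutte G x - (upperTutte G x)ᵀ

lemma tutte_map (f : R →+* R') (G : SimpleGraph V) (x : Matrix V V R) :
    (tutte G x).map f = tutte G (x.map f) := by
  ext i j
  simp [tutte, upperTutte, apply_ite f]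

lemma isAlternating_tutte (G : SimpleGraph V) (x : Matrix V V R) : IsAlternating (tutte G x) :=
  ⟨fun _ => sub_self _, by rw [tutte, transpose_sub, transpose_transpose, neg_sub]⟩

lemma adj_of_tutte_apply_ne_zero {G : SimpleGraph V} {x : Matrix V V R} {i j : V}
    (h : tutte G x i j ≠ 0) : G.Adj i j := by
  contrapose! h
  simp [tutte, upperTutte, h, G.adj_comm j i]

open Classical in
lemma tutte_matching_apply {G : SimpleGraph V} (M : G.Subgraph) (i j : V) :
    tutte G (of fun i j => if M.Adj i j then (1 : R) else 0) i j =
      if M.Adj i j then (if i < j then 1 else -1) else 0 := by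
  by_cases h : M.Adj i j
  · have hG := M.adj_sub h
    rcases hG.ne.lt_or_gt with hij | hij <;>
      simp [tutte, upperTutte, h, h.symm, hG, hG.symm, hij, hij.not_gt]
  · simp [tutte, upperTutte, h, M.adj_comm j i]

variable [Fintype V]

open Classical in
lemma tutte_matching_mul_self {G : SimpleGraph V} {M : G.Subgraph} (hM : M.IsMatching) :
    tutte G (of fun i j => if M.Adj i j then (1 : R) else 0) *
      tutte G (of fun i j => if M.Adj i j then (1 : R) else 0) =
      -diagonal fun v => if v ∈ M.verts then 1 else 0 := by
  have hT := tutte_matching_apply (R := R) M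
  have halt := isAlternating_tutte G (of fun i j => if M.Adj i j then (1 : R) else 0)
  set T := tutte G (of fun i j => if M.Adj i j then (1 : R) else 0)
  have hsq {i k : V} (h : M.Adj i k) : T i k * T k i = -1 := by
    rw [halt.apply_swap i k, hT, if_pos h]
    split_ifs <;> simp
  ext i j
  rw [mul_apply, neg_apply]
  by_cases hi : i ∈ M.verts
  · obtain ⟨k, hk, hunique⟩ := hM hi
    rw [Finset.sum_eq_single k (fun l _ hl => ?_) (by simp)]
    · rcases eq_or_ne i j with rfl | hij
      · rw [hsq hk, diagonal_apply_eq, if_pos hi]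
      · rw [hT k j, if_neg fun h => hij (hM.eq_of_adj_left hk.symm h), mul_zero,
          diagonal_apply_ne _ hij, neg_zero]
    · rw [hT i l, if_neg fun h => hl (hunique l h), zero_mul]
  · rw [Finset.sum_eq_zero fun k _ => by rw [hT i k, if_neg fun h => hi (M.edge_vert h), zero_mul],
      diagonal_apply, if_neg hi, ite_self, neg_zero]

end Tutte

/-! ### The matching number as the rank of a random Hankel matrix -/

section RandomHankel

open Matrix

variable {V R R' K : Type*} [Fintype V] [LinearOrder V] [CommRing R] [CommRing R'] [Field K]

/-- The matrix of the entries of `p` with label `b`. A single family `p` contains the weights of a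
Tutte matrix, with label `false`, and the entries of a second matrix, with label `true`. -/
def labelled (b : Bool) (p : V × Bool × V → R) : Matrix V V R :=
  of fun i j => p (i, b, j)

/-- The `r × r` Hankel matrix of the product of a Tutte matrix of `G` and a second matrix, where `p`
contains the weights of the former and the entries of the latter. -/
noncomputable def tutteHankel (r : ℕ) (G : SimpleGraph V) (p : V × Bool × V → R) :
    Matrix (Fin r) (Fin r) R :=
  hankel r (tutte G (labelled false p) * labelled true p)

lemma tutteHankel_map (f : R →+* R') (r : ℕ) (G : SimpleGraph V) (p : V × Bool × V → R) :
    (tutteHankel r G p).map f = tutteHankel r G (f ∘ p) := by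
  rw [tutteHankel, hankel_map, Matrix.map_mul, tutte_map]
  rfl

lemma rank_tutteHankel_le (r : ℕ) (G : SimpleGraph V) (p : V × Bool × V → K) :
    (tutteHankel r G p).rank ≤ 2 * matchingNumber G :=
  calc (tutteHankel r G p).rank
      ≤ (tutte G (labelled false p) * labelled true p).rank := rank_hankel_le _ _
    _ ≤ (tutte G (labelled false p)).rank := rank_mul_le_left _ _
    _ ≤ 2 * matchingNumber G := (isAlternating_tutte G _).rank_le_two_mul_matchingNumber
        fun _ _ => adj_of_tutte_apply_ne_zero

/-- The Tutte matrix `T` of a maximum matching satisfies `T * T = -D` for the diagonal indicator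
matrix `D` of the matched vertices, so that `T * (-T * diagonal c) = D * diagonal c`. -/
lemma exists_det_tutteHankel_ne_zero (c : V ↪ Kˣ) (G : SimpleGraph V) :
    ∃ p : V × Bool × V → K, (tutteHankel (2 * matchingNumber G) G p).det ≠ 0 := by
  classical
  obtain ⟨M, hM, hcard⟩ := exists_isMatching_ncard_eq_matchingNumber G
  let x : Matrix V V K := of fun i j => if M.Adj i j then 1 else 0
  let y : Matrix V V K := -tutte G x * diagonal fun v => (c v : K)
  let d : V → K := fun v => if v ∈ M.verts then (c v : K) else 0
  have hd_of_mem {v : V} (hv : v ∈ M.verts) : d v = c v := if_pos hv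
  have hTy : tutte G x * y = diagonal d := by
    change tutte G x * (-tutte G x * _) = _
    rw [Matrix.neg_mul, Matrix.mul_neg, ← Matrix.mul_assoc, tutte_matching_mul_self hM,
      Matrix.neg_mul, neg_neg, diagonal_mul_diagonal]
    simp only [ite_mul, one_mul, zero_mul, d]
  have e : Fin (2 * matchingNumber G) ≃ M.verts :=
    (finCongr (by rw [← hcard, ← ncard_verts_of_isMatching hM, Nat.card_coe_set_eq])).trans
      (Finite.equivFin M.verts).symm
  refine ⟨fun q => if q.2.1 then y q.1 q.2.2 else x q.1 q.2.2, ?_⟩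
  change (hankel _ (tutte G x * y)).det ≠ 0
  rw [hTy]
  refine det_hankel_diagonal_ne_zero (e.toEmbedding.trans (.subtype _)) (fun v => ?_)
    fun k l hkl => e.injective (Subtype.ext (c.injective (Units.ext ?_)))
  · by_cases hv : v ∈ M.verts
    · exact iff_of_true ⟨e.symm ⟨v, hv⟩, by simp⟩ (hd_of_mem hv ▸ (c v).ne_zero)
    · refine iff_of_false ?_ (not_not.mpr (if_neg hv))
      rintro ⟨k, rfl⟩
      exact hv (e k).2
  · exact (hd_of_mem (e k).2).symm.trans (hkl.trans (hd_of_mem (e l).2))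

section Degree

open MvPolynomial

variable {σ ι : Type*} [Fintype ι] {A B : Matrix ι ι (MvPolynomial σ R)} {a b : ℕ}

lemma totalDegree_mul_apply_le (hA : ∀ i j, (A i j).totalDegree ≤ a)
    (hB : ∀ i j, (B i j).totalDegree ≤ b) (i j : ι) : ((A * B) i j).totalDegree ≤ a + b := by
  rw [mul_apply]
  exact totalDegree_finsetSum_le fun k _ =>
    (totalDegree_mul _ _).trans (add_le_add (hA i k) (hB k j))

variable [DecidableEq ι]

lemma totalDegree_pow_apply_le (hA : ∀ i j, (A i j).totalDegree ≤ a) (k : ℕ) (i j : ι) :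
    ((A ^ k) i j).totalDegree ≤ k * a := by
  induction k generalizing i j with
  | zero =>
    rw [pow_zero, one_apply]
    split_ifs <;> simp
  | succ k ih =>
    rw [pow_succ, Nat.succ_mul]
    exact totalDegree_mul_apply_le ih hA i j

lemma totalDegree_det_le (hA : ∀ i j, (A i j).totalDegree ≤ a) :
    A.det.totalDegree ≤ Fintype.card ι * a := by
  rw [det_apply]
  refine totalDegree_finsetSum_le fun σ _ => ?_
  calc (Equiv.Perm.sign σ • ∏ i, A (σ i) i).totalDegree
      ≤ (∏ i, A (σ i) i).totalDegree := totalDegree_smul_le _ _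
    _ ≤ ∑ i, (A (σ i) i).totalDegree := totalDegree_finsetProd _ _
    _ ≤ ∑ _i : ι, a := Finset.sum_le_sum fun i _ => hA (σ i) i
    _ = Fintype.card ι * a := by simp

variable (R) in
lemma totalDegree_det_tutteHankel_le (r : ℕ) (G : SimpleGraph V) :
    (tutteHankel r G (X : V × Bool × V → MvPolynomial (V × Bool × V) R)).det.totalDegree ≤
      4 * r ^ 2 := by
  have hX (s : V × Bool × V) : (X s : MvPolynomial (V × Bool × V) R).totalDegree ≤ 1 :=
    (totalDegree_monomial_le _ _).trans (by simp)
  have hupper (i j : V) : (upperTutte G (labelled false X) i j :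
      MvPolynomial (V × Bool × V) R).totalDegree ≤ 1 := by
    simp only [upperTutte, of_apply]
    split_ifs
    · exact hX _
    · simp
  have hprod := totalDegree_mul_apply_le (A := tutte G (labelled false X))
    (B := labelled true (X : _ → MvPolynomial (V × Bool × V) R)) (fun i j =>
    (totalDegree_sub _ _).trans (max_le (hupper i j) (hupper j i))) fun i j => hX _
  refine (totalDegree_det_le (a := 4 * r) fun i j => ?_).trans (by
    rw [Fintype.card_fin]
    exact le_of_eq (by ring))
  simp only [tutteHankel, hankel, of_apply, one_dotProduct, mulVec, dotProduct_one]
  refine totalDegree_finsetSum_le fun u _ => totalDegree_finsetSum_le fun v _ =>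
    (totalDegree_pow_apply_le hprod _ u v).trans ?_
  omega

end Degree

open MvPolynomial

lemma prob_eval_eq_zero_le {σ : Type*} [Finite σ] [Finite K] {f : MvPolynomial σ K} (hf : f ≠ 0) :
    prob (fun p : σ → K => eval p f = 0) ≤ f.totalDegree / Nat.card K := by
  classical
  have := Fintype.ofFinite K
  let e := Finite.equivFin σ
  have hne : rename e f ≠ 0 := (map_ne_zero_iff _ (rename_injective e e.injective)).mpr hf
  have hdeg : (rename e f).totalDegree = f.totalDegree := totalDegree_renameEquiv e f
  have hSZ := schwartz_zippel_totalDegree hne Finset.univ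
  rw [hdeg] at hSZ
  calc prob (fun p : σ → K => eval p f = 0)
      = prob (fun q : Fin (Nat.card σ) → K => eval q (rename e f) = 0) := by
        rw [← prob_comp_equiv (e.symm.arrowCongr (Equiv.refl K))]
        simp only [eval_rename]
        rfl
    _ ≤ f.totalDegree / Nat.card K := by
        rw [prob, Nat.card_fun, Nat.card_fin, Nat.card_eq_fintype_card (α := K),
          Nat.card_eq_fintype_card, Fintype.card_subtype]
        rw [Fintype.piFinset_univ, Finset.card_univ] at hSZ
        simpa using (NNRat.cast_le (K := ℝ)).mpr hSZ

theorem le_prob_rank_tutteHankel_eq [Finite K] (hK : Nat.card V < Nat.card K) {G : SimpleGraph V}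
    {r : ℕ} (hr : 2 * matchingNumber G ≤ r) :
    1 - 4 * (r : ℝ) ^ 2 / Nat.card K ≤ prob fun p : V × Bool × V → K =>
      (tutteHankel r G p).rank = 2 * matchingNumber G := by
  obtain ⟨c⟩ : Nonempty (V ↪ Kˣ) := by
    have := Fintype.ofFinite Kˣ
    refine Function.Embedding.nonempty_of_card_le ?_
    rw [← Nat.card_eq_fintype_card, ← Nat.card_eq_fintype_card, Nat.card_units]
    omega
  obtain ⟨p₀, hp₀⟩ := exists_det_tutteHankel_ne_zero c G
  let D := (tutteHankel (2 * matchingNumber G) G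
    (X : V × Bool × V → MvPolynomial (V × Bool × V) K)).det
  have heval (p : V × Bool × V → K) :
      eval p D = (tutteHankel (2 * matchingNumber G) G p).det := by
    rw [RingHom.map_det, RingHom.mapMatrix_apply, tutteHankel_map]
    simp only [Function.comp_def, eval_X]
  have hD : D ≠ 0 := fun h => hp₀ (by rw [← heval, h, map_zero])
  have hdeg : D.totalDegree ≤ 4 * r ^ 2 :=
    (totalDegree_det_tutteHankel_le K _ G).trans
      (Nat.mul_le_mul_left 4 (Nat.pow_le_pow_left hr 2))
  calc 1 - 4 * (r : ℝ) ^ 2 / Nat.card K ≤ 1 - prob (fun p => eval p D = 0) := by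
        refine sub_le_sub_left ((prob_eval_eq_zero_le hD).trans ?_) 1
        gcongr
        exact_mod_cast hdeg
    _ = prob (fun p => ¬eval p D = 0) := (prob_not _).symm
    _ ≤ _ := prob_mono fun p hp => (rank_tutteHankel_le r G p).antisymm
        (le_rank_hankel hr (heval p ▸ hp))

end RandomHankel

/-! ### The protocol for the matching number -/

section MatchingProtocol

open Matrix

variable {n : ℕ} {S K : Type} [Field K] {T m t w : ℕ} {κ : Fin n → Setoid (Input n S)}
  {M : Input n S → Matrix (Fin n) (Fin n) K}

/-- The matrix whose `c`-th column is the Krylov vector `M ^ c 1` if `c < q`, and `0` otherwise. -/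
def krylovMatrix (q : ℕ) (M : Matrix (Fin n) (Fin n) K) : Matrix (Fin n) (Fin n) K :=
  of fun i c => if c < q then (M ^ (c : ℕ) *ᵥ 1) i else 0

lemma mul_krylovMatrix_apply {q : ℕ} (A M : Matrix (Fin n) (Fin n) K) (i : Fin n) {c : Fin n}
    (hc : c < q) : (A * krylovMatrix q M) i c = ((A * M ^ (c : ℕ)) *ᵥ 1) i := by
  rw [← mulVec_mulVec, mul_apply]
  simp only [krylovMatrix, of_apply, if_pos hc]
  rfl

/-- One product squares `M ^ 2 ^ ℓ`, and another one applies it to all known Krylov vectors. -/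
lemma Reachable.krylov (h : Reachable T κ) (enc : K ↪ (Fin w → Message n))
    (hr : HasMulRank K m t) (hm : 1 ≤ m) (ht : t ≤ n) (hM : KnowsRows κ M) (ℓ : ℕ) :
    ∃ κ' ≤ κ, Reachable (T + 2 * ℓ * matMulRounds n m w) κ' ∧
      KnowsRows κ' (fun a => M a ^ 2 ^ ℓ) ∧
      ∀ c < 2 ^ ℓ, c < 2 * n → ∀ v, Knows (κ' v) fun a => (M a ^ c *ᵥ 1) v := by
  induction ℓ with
  | zero =>
    refine ⟨κ, le_rfl, by simpa using h, by simpa using hM, fun c hc _ v => ?_⟩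
    obtain rfl : c = 0 := by omega
    simpa using Knows.const _
  | succ ℓ ih =>
    obtain ⟨κ₁, hκ₁, h₁, hpow, hvec⟩ := ih
    have hkrylov : KnowsRows κ₁ fun a => krylovMatrix (2 ^ ℓ) (M a) := fun v =>
      Knows.pi fun c => by
        by_cases hc : (c : ℕ) < 2 ^ ℓ
        · simpa only [krylovMatrix, of_apply, if_pos hc] using hvec c hc (by omega) v
        · simpa only [krylovMatrix, of_apply, if_neg hc] using Knows.const _
    obtain ⟨κ₂, hκ₂, h₂, hnew⟩ := h₁.matMul enc hr hm ht hpow hkrylov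
    obtain ⟨κ₃, hκ₃, h₃, hsq⟩ := h₂.matMul enc hr hm ht (hpow.mono hκ₂) (hpow.mono hκ₂)
    refine ⟨κ₃, hκ₃.trans (hκ₂.trans hκ₁), ?_, ?_, fun c hc hcn v => ?_⟩
    · convert h₃ using 1
      ring
    · simpa only [← pow_add, ← two_mul, ← pow_succ'] using hsq
    by_cases hlt : c < 2 ^ ℓ
    · exact (hvec c hlt hcn v).mono ((hκ₃.trans hκ₂) v)
    · obtain ⟨c, rfl⟩ := Nat.exists_eq_add_of_le (not_lt.mp hlt)
      have hc : c < 2 ^ ℓ := by omega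
      have := (hnew v).comp fun row => row ⟨c, by omega⟩
      simp only [mul_krylovMatrix_apply (c := ⟨c, _⟩) _ _ v hc, ← pow_add] at this
      exact this.mono (hκ₃ v)

/-- The entries of `M ^ k 1` for `k = 2 * c` and `k = 2 * c + 1` are sent to node `c`, which sends
their sums to all nodes. -/
lemma Reachable.hankel (h : Reachable T κ) (enc : K ↪ (Fin w → Message n))
    (hr : HasMulRank K m t) (hm : 1 ≤ m) (ht : t ≤ n) (hM : KnowsRows κ M) {ℓ : ℕ}
    (hℓ : 2 * n ≤ 2 ^ ℓ) :
    ∃ κ' ≤ κ, Reachable (T + 2 * ℓ * matMulRounds n m w + 16 * w) κ' ∧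
      ∀ v, Knows (κ' v) fun a => CongestedClique.hankel n (M a) := by
  let vec (k : Fin (n * 2)) (v : Fin n) (a : Input n S) : K := (M a ^ (k : ℕ) *ᵥ 1) v
  have hnode (v : Fin n) : Nat.card {x : Fin n × Fin n × Fin 2 // x.1 = v} ≤ 2 * n :=
    (card_fiber_le (g := Prod.snd) (fun _ _ hxy => hxy) v).trans (by simp [mul_comm])
  have hpower (c : Fin n) : Nat.card {x : Fin n × Fin n × Fin 2 // x.2.1 = c} ≤ 2 * n :=
    (card_fiber_le (f := fun x : Fin n × Fin n × Fin 2 => x.2.1) (g := fun x => (x.1, x.2.2))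
      (fun x y hxy => by simp_all [Prod.ext_iff]) c).trans (by simp [mul_comm])
  obtain ⟨κ₁, hκ₁, h₁, -, hvec⟩ := h.krylov enc hr hm ht hM ℓ
  obtain ⟨κ₂, hκ₂, h₂, hcollect⟩ := h₁.route enc hnode hpower
    (val := fun x => vec (finProdFinEquiv x.2) x.1) fun x =>
      hvec _ (by omega) (by omega) x.1
  obtain ⟨κ₃, hκ₃, h₃, hsum⟩ := h₂.route enc hpower hnode
    (val := fun x a => ∑ v, vec (finProdFinEquiv x.2) v a) fun x =>
      Knows.sum fun v _ => hcollect (v, x.2)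
  refine ⟨κ₃, hκ₃.trans (hκ₂.trans hκ₁), ?_, fun v => Knows.pi fun i => Knows.pi fun j => ?_⟩
  · convert h₃ using 1
    ring
  · have := hsum (v, finProdFinEquiv.symm ⟨i + j + 1, by omega⟩)
    simpa only [CongestedClique.hankel, of_apply, one_dotProduct, vec,
      Equiv.apply_symm_apply] using this

/-- The regrouping of seeds which makes the row `i` of each of the two matrices in `labelled` part
of the seed of node `i`. -/
def seedsEquiv (n : ℕ) (K : Type) : (Fin n → Bool → Fin n → K) ≃ (Fin n × Bool × Fin n → K) :=
  ((Equiv.refl _).arrowCongr (Equiv.curry _ _ _).symm).trans (Equiv.curry _ _ _).symm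

lemma exists_reachable_knowsRows_tutte (enc : K ↪ (Fin w → Message n)) :
    ∃ κ : Fin n → Setoid (Input n (Bool → Fin n → K)), Reachable w κ ∧
      KnowsRows κ (fun a => tutte a.1 (labelled false (seedsEquiv n K a.2))) ∧
      KnowsRows κ (fun a => labelled true (seedsEquiv n K a.2)) := by
  let U (a : Input n (Bool → Fin n → K)) := upperTutte a.1 (labelled false (seedsEquiv n K a.2))
  have hU (u v : Fin n) : Knows (Setoid.ker fun a : Input n (Bool → Fin n → K) =>
      (a.1.neighborSet u, a.2 u)) fun a => U a u v := by
    rintro ⟨G, ρ⟩ ⟨G', ρ'⟩ hab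
    obtain ⟨hG, hρ⟩ : G.neighborSet u = G'.neighborSet u ∧ ρ u = ρ' u := Prod.mk_inj.mp hab
    have hadj : G.Adj u v ↔ G'.Adj u v := Set.ext_iff.mp hG v
    have hweight : ρ u false v = ρ' u false v := by rw [hρ]
    classical
    exact if_congr (and_congr_right' hadj) hweight rfl
  obtain ⟨κ, hκ, h, hcol⟩ := Reachable.zero.exchange enc (fun u v a => U a u v) hU
  refine ⟨κ, by simpa using h, fun v => Knows.pi fun j => ?_, fun v a b hab => ?_⟩
  · exact ((hU v j).mono (hκ v)).comp₂ (hcol j v) (· - ·)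
  · exact congrFun (congrArg Prod.snd (hκ v hab)) true

theorem exists_protocol_matchingNumber [Finite K] {ℓ : ℕ} (enc : K ↪ (Fin w → Message n))
    (hr : HasMulRank K m t) (hm : 1 ≤ m) (ht : t ≤ n) (hℓ : 2 * n ≤ 2 ^ ℓ) (hK : n < Nat.card K) :
    ∃ P : CliqueProtocol n ℕ, ∀ G, 1 - 4 * (n : ℝ) ^ 2 / Nat.card K ≤
      P.successProb (17 * w + (2 * ℓ + 1) * matMulRounds n m w) G (matchingNumber G) := by
  obtain ⟨κ₁, h₁, htutte, hlabelled⟩ := exists_reachable_knowsRows_tutte enc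
  obtain ⟨κ₂, -, h₂, hprod⟩ := h₁.matMul enc hr hm ht htutte hlabelled
  obtain ⟨κ₃, -, h₃, hhankel⟩ := h₂.hankel enc hr hm ht hprod hℓ
  obtain ⟨P, hP⟩ := h₃.exists_protocol
    (fun a => (tutteHankel n a.1 (seedsEquiv n K a.2)).rank / 2) fun v =>
      (hhankel v).comp fun H => H.rank / 2
  refine ⟨P, fun G => ?_⟩
  obtain ⟨N, hN, hcard⟩ := exists_isMatching_ncard_eq_matchingNumber G
  calc 1 - 4 * (n : ℝ) ^ 2 / Nat.card K
      ≤ prob fun p : Fin n × Bool × Fin n → K =>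
          (tutteHankel n G p).rank = 2 * matchingNumber G :=
        le_prob_rank_tutteHankel_eq (by simpa using hK)
          (by simpa [hcard] using two_mul_ncard_edgeSet_le hN)
    _ = prob fun ρ => (tutteHankel n G (seedsEquiv n K ρ)).rank = 2 * matchingNumber G :=
        (prob_comp_equiv (seedsEquiv n K) _).symm
    _ ≤ prob fun ρ => (tutteHankel n G (seedsEquiv n K ρ)).rank / 2 = matchingNumber G :=
        prob_mono fun ρ hρ => by omega
    _ ≤ P.successProb _ G (matchingNumber G) := hP G _
    _ = _ := by
        congr 1
        ring

end MatchingProtocol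

/-! ### Round complexity -/

section RoundComplexity

lemma exists_hasMulRank_of_mulRankO {R : Type*} [CommRing R] {τ : ℝ} (hτ : 0 < τ)
    (h : MulRankO R τ) :
    ∃ D : ℝ, ∀ n : ℕ, 1 ≤ n → ∃ m t : ℕ, 1 ≤ m ∧ t ≤ n ∧ HasMulRank R m t ∧
      (n : ℝ) ^ (1 / τ) ≤ D * m := by
  obtain ⟨C₀, hC₀⟩ := h
  let C := max C₀ 1
  have hC : 0 < C := zero_lt_one.trans_le (le_max_right _ _)
  refine ⟨C ^ (1 / τ) * 2, fun n hn => ?_⟩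
  let y : ℝ := (n / C) ^ (1 / τ)
  have hy₀ : 0 ≤ y := by positivity
  have hy : (n : ℝ) ^ (1 / τ) = C ^ (1 / τ) * y := by
    rw [← Real.mul_rpow hC.le (by positivity), mul_div_cancel₀ _ hC.ne']
  have hyτ : C * y ^ τ = n := by
    rw [← Real.rpow_mul (by positivity), one_div_mul_cancel hτ.ne', Real.rpow_one,
      mul_div_cancel₀ _ hC.ne']
  suffices ∃ m t : ℕ, 1 ≤ m ∧ t ≤ n ∧ HasMulRank R m t ∧ y ≤ 2 * m by
    obtain ⟨m, t, hm, ht, hr, hym⟩ := this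
    refine ⟨m, t, hm, ht, hr, ?_⟩
    rw [hy, mul_assoc]
    gcongr
  have hfloor := Nat.lt_floor_add_one y
  obtain hsmall | hlarge := Nat.eq_zero_or_pos ⌊y⌋₊
  · refine ⟨1, 1, le_rfl, hn, .one, ?_⟩
    rw [hsmall] at hfloor
    norm_num at hfloor ⊢
    linarith
  · obtain ⟨t, ht, hr⟩ := hC₀ _ hlarge
    refine ⟨⌊y⌋₊, t, hlarge, (Nat.cast_le (α := ℝ)).mp ?_, hr, ?_⟩
    · calc (t : ℝ) ≤ C₀ * (⌊y⌋₊ : ℝ) ^ τ := ht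
        _ ≤ C * y ^ τ := by
            gcongr
            exacts [le_max_left _ _, Nat.floor_le hy₀]
        _ = n := hyτ
    · have : (1 : ℝ) ≤ ⌊y⌋₊ := by exact_mod_cast hlarge
      linarith

lemma add_mul_matMulRounds_le {n m w ℓ : ℕ} (hℓ : 1 ≤ ℓ) :
    17 * w + (2 * ℓ + 1) * matMulRounds n m w ≤ 4 * ℓ * matMulRounds n m w := by
  have : 17 * w ≤ matMulRounds n m w := by
    rw [matMulRounds]
    exact (Nat.mul_le_mul_right w (by norm_num)).trans (Nat.le_mul_of_pos_right _ (Nat.succ_pos _))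
  nlinarith

lemma matMulRounds_le {τ D : ℝ} (hτ : 2 ≤ τ) {n m w : ℕ} (hm : 1 ≤ m) (hmn : m ≤ n)
    (h : (n : ℝ) ^ (1 / τ) ≤ D * m) :
    (matMulRounds n m w : ℝ) ≤ 72 * w * ((4 * D ^ 2 + 1) * (n : ℝ) ^ (1 - 2 / τ)) := by
  have hm₀ : (0 : ℝ) < m := by exact_mod_cast hm
  have hn : (1 : ℝ) ≤ n := by exact_mod_cast hm.trans hmn
  have hn₀ : (0 : ℝ) < n := by linarith
  have hone : 1 ≤ (n : ℝ) ^ (1 - 2 / τ) :=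
    Real.one_le_rpow hn (sub_nonneg.mpr ((div_le_one (by linarith)).mpr hτ))
  have hpow : n / ((n : ℝ) ^ (1 / τ)) ^ 2 = (n : ℝ) ^ (1 - 2 / τ) := by
    rw [Real.rpow_sub hn₀, Real.rpow_one, ← Real.rpow_mul_natCast hn₀.le]
    congr 2
    push_cast
    ring
  have hblocks : (n : ℝ) / m + 1 ≤ 2 * (n / m) := by
    have : 1 ≤ (n : ℝ) / m := (one_le_div hm₀).mpr (by exact_mod_cast hmn)
    linarith
  have hmain : ((n : ℝ) / m + 1) ^ 2 / n ≤ 4 * D ^ 2 * (n : ℝ) ^ (1 - 2 / τ) :=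
    calc ((n : ℝ) / m + 1) ^ 2 / n ≤ (2 * (n / m)) ^ 2 / n := by gcongr
      _ = 4 * n / (m : ℝ) ^ 2 := by field_simp; ring
      _ ≤ 4 * D ^ 2 * (n / ((n : ℝ) ^ (1 / τ)) ^ 2) := by
          have : ((n : ℝ) ^ (1 / τ)) ^ 2 ≤ (D * m) ^ 2 := by gcongr
          rw [← mul_div_assoc, div_le_div_iff₀ (by positivity) (by positivity)]
          nlinarith
      _ = 4 * D ^ 2 * (n : ℝ) ^ (1 - 2 / τ) := by rw [hpow]
  have hfloor : (((n / m + 1) ^ 2 / n : ℕ) : ℝ) ≤ ((n : ℝ) / m + 1) ^ 2 / n := by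
    refine Nat.cast_div_le.trans ?_
    push_cast
    gcongr
    exact Nat.cast_div_le
  rw [matMulRounds]
  push_cast at hfloor ⊢
  gcongr
  linarith

/-- The field `K` is an extension of degree about `c log n / log (card F)`. -/
lemma exists_field_extension_embedding (F : Type*) [Field F] [Finite F] (c : ℕ) {n : ℕ}
    (hn : 2 ≤ n) :
    ∃ (K : Type) (_ : Field K) (_ : Finite K), Nonempty (F →+* K) ∧
      Nonempty (K ↪ (Fin (Nat.card F + c) → Message n)) ∧ n ^ c < Nat.card K := by
  obtain ⟨p, hp⟩ := CharP.exists F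
  have : Fact p.Prime := ⟨CharP.char_is_prime F p⟩
  let q := Nat.card F
  have hq : 1 < q := Finite.one_lt_card
  let d := Nat.log q (n ^ c) + 1
  let K := FiniteField.Extension F p d
  have hcard : Nat.card K = q ^ d := FiniteField.natCard_extension F p d
  refine ⟨K, inferInstance, inferInstance, ⟨algebraMap F K⟩, ?_,
    hcard ▸ Nat.lt_pow_succ_log_self hq _⟩
  have hclog : 2 ≤ 2 ^ Nat.clog 2 n := hn.trans (Nat.le_pow_clog one_lt_two n)
  have hle : q ^ d ≤ (2 ^ Nat.clog 2 n) ^ (q + c) :=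
    calc q ^ d = q * q ^ Nat.log q (n ^ c) := pow_succ' _ _
      _ ≤ 2 ^ q * n ^ c := by
          exact Nat.mul_le_mul Nat.lt_two_pow_self.le (Nat.pow_log_le_self q (by positivity))
      _ ≤ (2 ^ Nat.clog 2 n) ^ q * (2 ^ Nat.clog 2 n) ^ c := by
          gcongr
          exact Nat.le_pow_clog one_lt_two n
      _ = (2 ^ Nat.clog 2 n) ^ (q + c) := (pow_add _ _ _).symm
  have := Fintype.ofFinite K
  refine Function.Embedding.nonempty_of_card_le ?_
  rw [← Nat.card_eq_fintype_card, hcard]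
  simpa using hle

lemma natLog_add_two_le {n : ℕ} (hn : 2 ≤ n) :
    ((Nat.log 2 n + 2 : ℕ) : ℝ) ≤ 3 / Real.log 2 * Real.log n := by
  have hlog : (Nat.log 2 n : ℝ) ≤ Real.logb 2 n := by simpa using Real.natLog_le_logb n 2
  have hone : 1 ≤ Real.logb 2 n := by
    rw [Real.le_logb_iff_rpow_le one_lt_two (by positivity), Real.rpow_one]
    exact_mod_cast hn
  rw [div_mul_eq_mul_div, mul_div_assoc, Real.log_div_log]
  push_cast
  linarith

lemma four_mul_sq_div_le {n c N : ℕ} (hn : 2 ≤ n) (hN : n ^ (c + 4) ≤ N) :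
    4 * (n : ℝ) ^ 2 / N ≤ 1 / (n : ℝ) ^ c := by
  have : (0 : ℝ) < n := by positivity
  have hfour : (4 : ℝ) ≤ (n : ℝ) ^ 2 := by
    exact_mod_cast Nat.pow_le_pow_left hn 2
  have hN' : (n : ℝ) ^ (c + 4) ≤ N := by exact_mod_cast hN
  calc 4 * (n : ℝ) ^ 2 / N ≤ (n : ℝ) ^ 2 * (n : ℝ) ^ 2 / (n : ℝ) ^ (c + 4) := by gcongr
    _ = 1 / (n : ℝ) ^ c := by
        field_simp
        ring

theorem randomizedRoundsO_matchingNumber {F : Type*} [Field F] [Finite F] {τ : ℝ}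
    (h : MulRankO F τ) :
    RandomizedRoundsO (fun _ G => matchingNumber G)
      (fun n => (n : ℝ) ^ (1 - 2 / τ) * Real.log n) := by
  have hτ := h.two_le
  obtain ⟨D, hD⟩ := exists_hasMulRank_of_mulRankO (by linarith) h
  intro c
  let w := Nat.card F + (c + 4)
  refine ⟨4 * (3 / Real.log 2) * (72 * w * (4 * D ^ 2 + 1)), fun n hn => ?_⟩
  obtain ⟨K, _, _, ⟨φ⟩, ⟨enc⟩, hK⟩ := exists_field_extension_embedding F (c + 4) hn
  obtain ⟨m, t, hm, ht, hr, hnm⟩ := hD n (by omega)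
  let ℓ := Nat.log 2 n + 2
  have hℓ : 2 * n ≤ 2 ^ ℓ :=
    calc 2 * n ≤ 2 * 2 ^ (Nat.log 2 n + 1) := by
          gcongr
          exact (Nat.lt_pow_succ_log_self one_lt_two n).le
      _ = 2 ^ ℓ := (pow_succ' _ _).symm
  obtain ⟨P, hP⟩ := exists_protocol_matchingNumber enc (hr.map φ) hm ht hℓ
    ((Nat.le_self_pow (by omega) n).trans_lt hK)
  refine ⟨P, _, ?_, fun G => (sub_le_sub_left (four_mul_sq_div_le hn hK.le) 1).trans (hP G)⟩
  have hmatMul := matMulRounds_le (w := w) hτ hm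
    ((Nat.le_mul_self m).trans (hr.mul_self_le.trans ht)) hnm
  calc ((17 * w + (2 * ℓ + 1) * matMulRounds n m w : ℕ) : ℝ)
      ≤ ((4 * ℓ * matMulRounds n m w : ℕ) : ℝ) := by
        exact_mod_cast add_mul_matMulRounds_le (Nat.le_add_left 1 _)
    _ = 4 * ℓ * matMulRounds n m w := by push_cast; rfl
    _ ≤ 4 * (3 / Real.log 2 * Real.log n) *
          (72 * w * ((4 * D ^ 2 + 1) * (n : ℝ) ^ (1 - 2 / τ))) := by
        gcongr
        exact natLog_add_two_le hn
    _ = _ := by ring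

lemma _root_.RandomizedRoundsO.mono {Out : Type} {f : ∀ n : ℕ, SimpleGraph (Fin n) → Out}
    {g g' : ℕ → ℝ} (h : RandomizedRoundsO f g) (hg : ∀ n, 2 ≤ n → |g n| ≤ g' n) :
    RandomizedRoundsO f g' := by
  intro c
  obtain ⟨C, hC⟩ := h c
  refine ⟨|C|, fun n hn => ?_⟩
  obtain ⟨P, T, hT, hP⟩ := hC n hn
  refine ⟨P, T, ?_, hP⟩
  calc (T : ℝ) ≤ |C * g n| := hT.trans (le_abs_self _)
    _ = |C| * |g n| := abs_mul _ _
    _ ≤ |C| * g' n := by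
        gcongr
        exact hg n hn

lemma one_sub_two_div_add_le {ω ε : ℝ} (hω : 2 ≤ ω) (hε : 0 ≤ ε) :
    1 - 2 / (ω + ε) ≤ 1 - 2 / ω + ε := by
  have hdiff : 2 / ω - 2 / (ω + ε) ≤ ε := by
    rw [div_sub_div _ _ (by linarith) (by linarith), div_le_iff₀ (by nlinarith)]
    have : 2 ≤ ω * (ω + ε) := by nlinarith
    nlinarith
  linarith

lemma randomizedRoundsO_matchingNumber_omegaExponent (F : Type*) [Field F] {ε : ℝ} (hε : 0 < ε) :
    RandomizedRoundsO (fun _ G => matchingNumber G)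
      (fun n => (n : ℝ) ^ (1 - 2 / omegaExponent F + ε) * Real.log n) := by
  obtain ⟨k, _, _, hk⟩ := (squareProductRankO_omegaExponent_add F
    (half_pos hε)).mulRankO.exists_finite_field (half_pos hε)
  rw [add_assoc, add_halves] at hk
  refine (randomizedRoundsO_matchingNumber hk).mono fun n hn => ?_
  rw [abs_of_nonneg (by positivity)]
  gcongr
  · exact_mod_cast one_le_two.trans hn
  · exact one_sub_two_div_add_le (two_le_omegaExponent F) hε.le

end RoundComplexity

end CongestedClique

theorem theorem7 (F : Type*) [Field F] :
    (∀ ε : ℝ, 0 < ε →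
      RandomizedRoundsO (fun _ G => matchingNumber G)
        (fun n => (n : ℝ) ^ (1 - 2 / omegaExponent F + ε) * Real.log n)) ∧
    (Finite F → ∀ τ : ℝ, SquareProductRankO F τ →
      RandomizedRoundsO (fun _ G => matchingNumber G)
        (fun n => (n : ℝ) ^ (1 - 2 / τ) * Real.log n)) :=
  ⟨fun _ hε => CongestedClique.randomizedRoundsO_matchingNumber_omegaExponent F hε,
    fun _ _ hτ => CongestedClique.randomizedRoundsO_matchingNumber hτ.mulRankO⟩
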